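/- Let $m<n$ be real numbers, $\sigma,\varrho>0$, $0<\kappa<\mu\le 1$, and let $\Phi:[m,n]\to\mathbb R$ be increasing and differentiable with $\Phi'(\ell)\ne 0$ for all $\ell\in[m,n]$ (derivatives on $[m,n]$ are one-sided at the end points). Write $\mathbb M_p(x)=\sum_{k\ge 0}x^k/\Gamma(pk+1)$ for the Mittag-Leffler function, let $$\mathbb I^{\nu;\Phi}z(\ell)=\int_m^\ell\frac{\Phi'(\eta)(\Phi(\ell)-\Phi(\eta))^{\nu-1}}{\Gamma(\nu)}\,z(\eta)\,d\eta\quad(\nu>0),\qquad \mathbb I^{0;\Phi}z=z,$$ and, for $0<\nu\le 1$, let $${}^c\mathbb D^{\nu;\Phi}z(\ell)=\frac{1}{\Phi'(\ell)}\frac{d}{d\ell}\,\mathbb I^{1-\nu;\Phi}\bigl(z-z(m)\bigr)(\ell)$$ be the $\Phi$-Caputo derivative (which equals $\mathbb I^{1-\nu;\Phi}(z'/\Phi')$ when $z$ and $\Phi$ are $C^1$). Assume: (H1) $f:[m,n]\to[m-\sigma,n]$ is continuous and $f(\ell)\le\ell$ for all $\ell\in[m,n]$; (H2) $Q:[m,n]\times\mathbb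 R^2\to\mathbb R$ is continuous and there is $L_Q>0$ with $|Q(\ell,b_2,a_2)-Q(\ell,b_1,a_1)|\le L_Q(|b_2-b_1|+|a_2-a_1|)$ for all $\ell\in[m,n]$ and $a_1,a_2,b_1,b_2\in\mathbb R$. Consider the delay equation $${}^c\mathbb D^{\mu;\Phi}z(\ell)+\varrho\,{}^c\mathbb D^{\kappa;\Phi}z(\ell)=Q\bigl(\ell,z(\ell),z(f(\ell))\bigr),\qquad \ell\in[m,n],\tag{E}$$ whose solutions are the functions $z\in C([m-\sigma,n],\mathbb R)$ for which both fractional derivatives exist at every point of $[m,n]$ and (E) holds there. Put $c=\mathbb M_\mu\bigl(2L_Q(\Phi(n)-\Phi(m))^\mu\bigr)$. Then $c>0$, and (E) is Ulam–Hyers–Mittag-Leffler stable with the constant $c$: for every $\varepsilon>0$ and every $\tilde z\in C([m-\sigma,n],\mathbb R)$ for which both fractional derivatives exist at every point of $[m,n]$ and $$\Bigl|{}^c\mathbb D^{\mu;\Phi}\tilde z(\ell)+\varrho\,{}^c\mathbb D^{\kappa;\Phi}\tilde z(\ell)-Q\bigl(\ell,\tilde z(\ell),\tilde z(f(\ell))\bigr)\Bigr|\le\varepsilon\,\mathbb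 M_\mu\bigl((\Phi(\ell)-\Phi(m))^\mu\bigr),\qquad \ell\in[m,n],$$ there is a unique solution $z$ of (E) with $z=\tilde z$ on $[m-\sigma,m]$, and it satisfies $$|\tilde z(\ell)-z(\ell)|\le c\,\varepsilon\,\mathbb M_\mu\bigl((\Phi(\ell)-\Phi(m))^\mu\bigr),\qquad \ell\in[m,n].$$ -/

import Mathlib

noncomputable section

namespace PhiCaputo

/-- The one-parameter Mittag-Leffler function `M_p(x) = ∑ x ^ k / Γ(p k + 1)`. -/
def mittagLeffler (p x : ℝ) : ℝ :=
  ∑' k : ℕ, x ^ k / Real.Gamma (p * k + 1)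

/-- The derivative `Φ'` of a function on the interval `[m, n]` (one-sided at the end points). -/
def dPhi (m n : ℝ) (Φ : ℝ → ℝ) (l : ℝ) : ℝ :=
  derivWithin Φ (Set.Icc m n) l

/-- The Riemann-Liouville integral of order `ν ≥ 0` with respect to `Φ`, based at `m`;
the integral of order `0` is the identity. -/
def fracIntegral (m n : ℝ) (Φ : ℝ → ℝ) (ν : ℝ) (z : ℝ → ℝ) (l : ℝ) : ℝ :=
  if ν = 0 then z l
  else ∫ s in m..l, dPhi m n Φ s * (Φ l - Φ s) ^ (ν - 1) / Real.Gamma ν * z s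

/-- The function `I^{1-ν;Φ} (z - z(m))`, whose `Φ`-derivative `(1/Φ') d/dl` is the `Φ`-Caputo
derivative of `z` of order `ν`. -/
def caputoPrimitive (m n : ℝ) (Φ : ℝ → ℝ) (ν : ℝ) (z : ℝ → ℝ) : ℝ → ℝ :=
  fracIntegral m n Φ (1 - ν) (fun s => z s - z m)

/-- `z` has a `Φ`-Caputo derivative of order `ν ∈ (0, 1]` at the point `l` of `[m, n]`. -/
def CaputoDifferentiableAt (m n : ℝ) (Φ : ℝ → ℝ) (ν : ℝ) (z : ℝ → ℝ) (l : ℝ) : Prop :=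
  DifferentiableWithinAt ℝ (caputoPrimitive m n Φ ν z) (Set.Icc m n) l

/-- The `Φ`-Caputo derivative of order `ν ∈ (0, 1]`, in the form that makes sense for continuous
functions: the `Φ`-Riemann-Liouville derivative of `z - z(m)`,
`(1/Φ'(l)) d/dl I^{1-ν;Φ} (z - z(m)) (l)`. For continuously differentiable `Φ` and `z` this is
`I^{1-ν;Φ} (z'/Φ') (l)`, and for `ν = 1` it is `z'(l)/Φ'(l)`. -/
def caputoDeriv (m n : ℝ) (Φ : ℝ → ℝ) (ν : ℝ) (z : ℝ → ℝ) (l : ℝ) : ℝ :=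
  derivWithin (caputoPrimitive m n Φ ν z) (Set.Icc m n) l / dPhi m n Φ l

/-- The residual `D^μ z (l) + ϱ D^κ z (l) - Q(l, z(l), z(f(l)))` of the delay equation. -/
def residual (m n : ℝ) (Φ : ℝ → ℝ) (μ κ ϱ : ℝ) (Q : ℝ → ℝ → ℝ → ℝ) (f z : ℝ → ℝ) (l : ℝ) : ℝ :=
  caputoDeriv m n Φ μ z l + ϱ * caputoDeriv m n Φ κ z l - Q l (z l) (z (f l))

/-- `z` is continuous on `[m - σ, n]` and its `Φ`-Caputo derivatives of orders `μ` and `κ` exist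
at every point of `[m, n]`. -/
def Admissible (m n σ : ℝ) (Φ : ℝ → ℝ) (μ κ : ℝ) (z : ℝ → ℝ) : Prop :=
  ContinuousOn z (Set.Icc (m - σ) n) ∧
  ∀ l ∈ Set.Icc m n,
    CaputoDifferentiableAt m n Φ μ z l ∧ CaputoDifferentiableAt m n Φ κ z l

/-- `z` is a solution of the delay problem
`D^μ z (l) + ϱ D^κ z (l) = Q(l, z(l), z(f(l)))` on `[m, n]`, `z = α` on `[m - σ, m]`. -/
def IsSolution (m n σ : ℝ) (Φ : ℝ → ℝ) (μ κ ϱ : ℝ) (Q : ℝ → ℝ → ℝ → ℝ) (f α z : ℝ → ℝ) : Prop :=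
  Admissible m n σ Φ μ κ z ∧
  (∀ l ∈ Set.Icc m n,
    caputoDeriv m n Φ μ z l + ϱ * caputoDeriv m n Φ κ z l = Q l (z l) (z (f l))) ∧
  ∀ l ∈ Set.Icc (m - σ) m, z l = α l

/-- `y` solves the inequality `|residual of y| ≤ ε M_μ((Φ(l) - Φ(m))^μ)` on `[m, n]`. -/
def IsApproxSolution (m n σ : ℝ) (Φ : ℝ → ℝ) (μ κ ϱ : ℝ) (Q : ℝ → ℝ → ℝ → ℝ) (f : ℝ → ℝ)
    (ε : ℝ) (y : ℝ → ℝ) : Prop :=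
  Admissible m n σ Φ μ κ y ∧
  ∀ l ∈ Set.Icc m n,
    |residual m n Φ μ κ ϱ Q f y l| ≤ ε * mittagLeffler μ ((Φ l - Φ m) ^ μ)

/-- Ulam-Hyers-Mittag-Leffler stability with the constant `c`: for every `ε > 0` and every
solution `y` of the inequality there is exactly one solution `z` of the equation (up to equality
on `[m - σ, n]`) with the same initial data as `y`, and `|y - z| ≤ c ε M_μ((Φ(l) - Φ(m))^μ)` on
`[m, n]`. -/
def IsUHMLStableWith (m n σ : ℝ) (Φ : ℝ → ℝ) (μ κ ϱ : ℝ) (Q : ℝ → ℝ → ℝ → ℝ) (f : ℝ → ℝ)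
    (c : ℝ) : Prop :=
  ∀ ε : ℝ, 0 < ε → ∀ y : ℝ → ℝ, IsApproxSolution m n σ Φ μ κ ϱ Q f ε y →
    ∃ z : ℝ → ℝ, IsSolution m n σ Φ μ κ ϱ Q f y z ∧
      (∀ w : ℝ → ℝ, IsSolution m n σ Φ μ κ ϱ Q f y w → Set.EqOn w z (Set.Icc (m - σ) n)) ∧
      (∀ l ∈ Set.Icc (m - σ) m, |y l - z l| = 0) ∧
      ∀ l ∈ Set.Icc m n, |y l - z l| ≤ c * ε * mittagLeffler μ ((Φ l - Φ m) ^ μ)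

/-- Ulam-Hyers-Mittag-Leffler stability with respect to `M_μ((Φ(l) - Φ(m))^μ)`. -/
def IsUHMLStable (m n σ : ℝ) (Φ : ℝ → ℝ) (μ κ ϱ : ℝ) (Q : ℝ → ℝ → ℝ → ℝ) (f : ℝ → ℝ) : Prop :=
  ∃ c : ℝ, 0 < c ∧ IsUHMLStableWith m n σ Φ μ κ ϱ Q f c

end PhiCaputo

end

/-!
In the time `t = Φ(l) - Φ(m)` the `Φ`-Caputo derivatives become ordinary Caputo derivatives based
at `0`; only differentiability of `Φ` is needed, since the change of variables
`caputoPrimitive_eq_rlInt₀` and the inverse function rule hold without continuity of `Φ'`. Write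
`J^a` for the Riemann-Liouville integral `rlInt a` and `u = z - z(m)` in the new time. By the
semigroup property `rlInt_rlInt`, an equation `D^μ u + ϱ D^κ u = h` with bounded `h` integrates to
`u + ϱ J^(μ-κ) u = J^μ h` (`two_term_of_hasDerivAt`).

Existence. With `w = D^μ z` as unknown, so that `z = z(m) + J^μ w`, the equation reads
`w + ϱ J^(μ-κ) w = Q(l, z, z ∘ f)`. The estimate `J^a e^(ct) ≤ c^(-a) e^(ct)` makes this a
contraction in the norm `sup |w| e^(-ct)` for large `c`, and `z(m) + J^μ w` has both fractional
derivatives at every point, the end points included (`exists_isSolution`).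

Stability. The difference `e` of an approximate and an exact solution satisfies
`e + ϱ J^(μ-κ) e = J^μ h` with `|h| ≤ L (|e| + |e ∘ f|) + ε M_μ(t^μ)`. The constant in the theorem
does not depend on `ϱ` because the term with `ϱ` only damps: `|e| ≤ J^μ |h|`
(`abs_le_rlInt_of_two_term`). This follows from the maximum principle for the relaxation equation
`D^α v + ϱ v = h`, `α = μ - κ` (`relaxation_nonneg`), since `e = J^κ v`. The maximum principle is
proved for sources that are merely bounded: if `J^α p ≥ 0` up to `t₁`, the part of `J^α p` at a
later time that stems from `[0, t₁]` is nonnegative, because the kernel `(t₀ - s)^(α-1)` is on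
`[0, t₁]` a positive superposition of the kernels `(τ - s)^(α-1)`, `τ ≤ t₁`
(`setIntegral_past_nonneg`). Finally `J^μ M_μ(t^μ) ≤ M_μ(t^μ)`, and a Gronwall iteration over
monotone bounds, which a delay `f(l) ≤ l` respects, gives the factor `M_μ(2L t^μ)`
(`le_mittagLeffler_of_improving_bound`). The estimate with `ε = 0` is uniqueness.
-/

namespace PhiCaputo

open MeasureTheory Set Filter Topology

/-! ### Weakly singular kernels and the Beta integral -/

lemma integrableOn_sub_rpow {a : ℝ} (ha : 0 < a) (c t : ℝ) :
    IntegrableOn (fun s : ℝ => (t - s) ^ (a - 1)) (Ioc c t) := by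
  rcases le_or_gt c t with h | h
  · have h1 : IntervalIntegrable (fun x : ℝ => x ^ (a - 1)) volume (t - c) (t - t) :=
      intervalIntegral.intervalIntegrable_rpow' (by linarith)
    have h2 := h1.comp_sub_left t
    simp only [sub_sub_cancel] at h2
    exact (intervalIntegrable_iff_integrableOn_Ioc_of_le h).1 h2
  · simp [Ioc_eq_empty_of_le h.le]

lemma setIntegral_sub_rpow {a c t : ℝ} (ha : 0 < a) (h : c ≤ t) :
    ∫ s in Ioc c t, (t - s) ^ (a - 1) = (t - c) ^ a / a := by
  rw [← intervalIntegral.integral_of_le h,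
    intervalIntegral.integral_comp_sub_left (fun x : ℝ => x ^ (a - 1)) t, sub_self,
    integral_rpow (Or.inl (by linarith))]
  simp [ha.ne']

lemma setIntegral_rpow_mul_sub_rpow {a b L : ℝ} (ha : 0 < a) (hb : 0 < b) (hL : 0 < L) :
    ∫ x in Ioc 0 L, x ^ (a - 1) * (L - x) ^ (b - 1)
      = L ^ (a + b - 1) * ProbabilityTheory.beta a b := by
  have h := Complex.betaIntegral_scaled a b hL
  have h1 : ∫ x in (0 : ℝ)..L, (x : ℂ) ^ ((a : ℂ) - 1) * ((L : ℂ) - x) ^ ((b : ℂ) - 1)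
      = ((∫ x in Ioc 0 L, x ^ (a - 1) * (L - x) ^ (b - 1) : ℝ) : ℂ) := by
    rw [intervalIntegral.integral_of_le hL.le, ← integral_complex_ofReal]
    refine setIntegral_congr_fun measurableSet_Ioc fun x hx => ?_
    simp only [Complex.ofReal_mul]
    rw [Complex.ofReal_cpow hx.1.le, Complex.ofReal_cpow (sub_nonneg.2 hx.2)]
    push_cast
    rfl
  rw [h1] at h
  have h2 := congrArg Complex.re h
  have h3 : (L : ℂ) ^ ((a : ℂ) + b - 1) = ((L ^ (a + b - 1) : ℝ) : ℂ) := by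
    rw [Complex.ofReal_cpow hL.le]
    push_cast
    rfl
  rw [h3, Complex.ofReal_re, Complex.re_ofReal_mul] at h2
  rw [h2, ProbabilityTheory.beta_eq_betaIntegralReal a b ha hb]

lemma setIntegral_sub_rpow_mul_sub_rpow {a b s t : ℝ} (ha : 0 < a) (hb : 0 < b) (h : s < t) :
    ∫ x in Ioc s t, (t - x) ^ (a - 1) * (x - s) ^ (b - 1)
      = (t - s) ^ (a + b - 1) * ProbabilityTheory.beta a b := by
  have h1 := setIntegral_rpow_mul_sub_rpow hb ha (sub_pos.2 h)
  rw [← intervalIntegral.integral_of_le (sub_pos.2 h).le] at h1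
  rw [← intervalIntegral.integral_of_le h.le]
  have h2 := intervalIntegral.integral_comp_sub_right (a := s) (b := t)
    (fun x : ℝ => x ^ (b - 1) * (t - s - x) ^ (a - 1)) s
  rw [sub_self, h1] at h2
  rw [show ProbabilityTheory.beta a b = ProbabilityTheory.beta b a by
    simp [ProbabilityTheory.beta, mul_comm, add_comm], add_comm a b, ← h2]
  refine intervalIntegral.integral_congr fun x _ => ?_
  rw [mul_comm, sub_sub_sub_cancel_right]

lemma integrableOn_sub_rpow_mul_sub_rpow {a b s t : ℝ} (ha : 0 < a) (hb : 0 < b) (h : s < t) :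
    IntegrableOn (fun x : ℝ => (t - x) ^ (a - 1) * (x - s) ^ (b - 1)) (Ioc s t) := by
  refine Integrable.of_integral_ne_zero ?_
  rw [setIntegral_sub_rpow_mul_sub_rpow ha hb h]
  exact (mul_pos (Real.rpow_pos_of_pos (sub_pos.2 h) _) (ProbabilityTheory.beta_pos ha hb)).ne'

/-- Dirichlet's exchange of the order of integration over a triangle, for an iterated integral
with nonnegative kernels `K`, `k` and a bounded function `p`. -/
lemma setIntegral_triangle_swap {t M : ℝ} {K k p G : ℝ → ℝ} (hK : Measurable K) (hk : Measurable k)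
    (hp : Measurable p) (hK0 : ∀ τ ∈ Ioc 0 t, 0 ≤ K τ) (hk0 : ∀ x, 0 < x → 0 ≤ k x)
    (hpM : ∀ s ∈ Ioc 0 t, |p s| ≤ M)
    (hint : ∀ s ∈ Ioo 0 t, IntegrableOn (fun τ => K τ * k (τ - s)) (Ioc s t))
    (hG : ∀ s ∈ Ioo 0 t, ∫ τ in Ioc s t, K τ * k (τ - s) = G s)
    (hGi : IntegrableOn G (Ioc 0 t)) :
    ∫ τ in Ioc 0 t, K τ * ∫ s in Ioc 0 τ, k (τ - s) * p s = ∫ s in Ioc 0 t, G s * p s := by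
  set F : ℝ → ℝ → ℝ := fun τ s => if s < τ then K τ * k (τ - s) * p s else 0 with hF
  have hFm : Measurable (Function.uncurry F) := by
    refine Measurable.ite (measurableSet_lt measurable_snd measurable_fst) ?_ measurable_const
    exact ((hK.comp measurable_fst).mul (hk.comp (measurable_fst.sub measurable_snd))).mul
      (hp.comp measurable_snd)
  have hrow : ∀ s ∈ Ioo 0 t, (Ioc 0 t).indicator (fun τ => F τ s)
      = (Ioc s t).indicator (fun τ => K τ * k (τ - s) * p s) := by
    intro s hs
    ext τ
    by_cases h1 : s < τ
    · by_cases h2 : τ ≤ t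
      · rw [indicator_of_mem (show τ ∈ Ioc 0 t from ⟨hs.1.trans h1, h2⟩),
          indicator_of_mem (show τ ∈ Ioc s t from ⟨h1, h2⟩)]
        simp [hF, h1]
      · rw [indicator_of_notMem (fun h => h2 h.2), indicator_of_notMem (fun h => h2 h.2)]
    · rw [indicator_of_notMem (fun h : τ ∈ Ioc s t => h1 h.1)]
      simp [hF, h1]
  have hrowint : ∀ s ∈ Ioo 0 t, IntegrableOn (fun τ => F τ s) (Ioc 0 t) := by
    intro s hs
    rw [← integrable_indicator_iff measurableSet_Ioc, hrow s hs,
      integrable_indicator_iff measurableSet_Ioc]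
    exact (hint s hs).mul_const _
  have hFi : Integrable (Function.uncurry F)
      ((volume.restrict (Ioc 0 t)).prod (volume.restrict (Ioo 0 t))) := by
    rw [integrable_prod_iff' hFm.aestronglyMeasurable]
    constructor
    · filter_upwards [ae_restrict_mem measurableSet_Ioo] with s hs using hrowint s hs
    · refine Integrable.mono' ((hGi.mono_set Ioo_subset_Ioc_self).mul_const M)
        (hFm.norm.stronglyMeasurable.integral_prod_left'.aestronglyMeasurable) ?_
      filter_upwards [ae_restrict_mem measurableSet_Ioo] with s hs
      rw [Real.norm_of_nonneg (integral_nonneg fun _ => norm_nonneg _), ← hG s hs,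
        ← integral_mul_const, ← integral_indicator measurableSet_Ioc,
        ← integral_indicator measurableSet_Ioc]
      refine integral_mono_of_nonneg (Eventually.of_forall fun τ => ?_) ?_
        (Eventually.of_forall fun τ => ?_)
      · exact indicator_nonneg (fun _ _ => norm_nonneg _) _
      · exact (integrable_indicator_iff measurableSet_Ioc).2 ((hint s hs).mul_const M)
      · have := congrFun (hrow s hs) τ
        have e : (Ioc 0 t).indicator (fun τ => ‖Function.uncurry F (τ, s)‖) τ
            = ‖(Ioc 0 t).indicator (fun τ => F τ s) τ‖ := by
          rw [norm_indicator_eq_indicator_norm]; rfl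
        rw [e, this]
        by_cases h1 : τ ∈ Ioc s t
        · rw [indicator_of_mem h1, indicator_of_mem h1, Real.norm_eq_abs, abs_mul,
            abs_of_nonneg (mul_nonneg (hK0 τ ⟨hs.1.trans h1.1, h1.2⟩) (hk0 _ (sub_pos.2 h1.1)))]
          exact mul_le_mul_of_nonneg_left (hpM s ⟨hs.1, hs.2.le⟩)
            (mul_nonneg (hK0 τ ⟨hs.1.trans h1.1, h1.2⟩) (hk0 _ (sub_pos.2 h1.1)))
        · rw [indicator_of_notMem h1, indicator_of_notMem h1, norm_zero]
  have hswap := integral_integral_swap hFi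
  have hL : ∫ τ in Ioc 0 t, K τ * ∫ s in Ioc 0 τ, k (τ - s) * p s
      = ∫ τ in Ioc 0 t, ∫ s in Ioo 0 t, F τ s := by
    refine setIntegral_congr_fun measurableSet_Ioc fun τ hτ => ?_
    rw [integral_Ioc_eq_integral_Ioo, ← integral_const_mul, ← integral_indicator measurableSet_Ioo,
      ← integral_indicator measurableSet_Ioo]
    congr 1
    ext s
    by_cases h1 : s ∈ Ioo 0 τ
    · rw [indicator_of_mem h1, indicator_of_mem (show s ∈ Ioo 0 t from ⟨h1.1, h1.2.trans_le hτ.2⟩)]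
      simp [hF, h1.2, mul_assoc]
    · rw [indicator_of_notMem h1]
      by_cases h2 : s ∈ Ioo 0 t
      · rw [indicator_of_mem h2]
        have : ¬ s < τ := fun h => h1 ⟨h2.1, h⟩
        simp [hF, this]
      · rw [indicator_of_notMem h2]
  rw [hL, hswap, integral_Ioc_eq_integral_Ioo]
  refine setIntegral_congr_fun measurableSet_Ioo fun s hs => ?_
  rw [← hG s hs, ← integral_mul_const, ← integral_indicator measurableSet_Ioc,
    ← integral_indicator measurableSet_Ioc]
  exact congrArg (fun g : ℝ → ℝ => ∫ x, g x) (hrow s hs)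

/-! ### The Riemann-Liouville integral on the half-line -/

/-- Measurable functions that are bounded on every interval `[0, T]`: the class on which the
Riemann-Liouville integrals based at `0` are studied. -/
structure LocBdd (p : ℝ → ℝ) : Prop where
  measurable : Measurable p
  bound : ∀ T : ℝ, ∃ M : ℝ, 0 ≤ M ∧ ∀ t ∈ Icc 0 T, |p t| ≤ M

lemma _root_.Continuous.locBdd {p : ℝ → ℝ} (hp : Continuous p) : LocBdd p where
  measurable := hp.measurable
  bound T := by
    obtain ⟨M, hM⟩ := isCompact_Icc.exists_bound_of_continuousOn (s := Icc 0 T) hp.continuousOn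
    exact ⟨|M|, abs_nonneg _, fun t ht => (hM t ht).trans (le_abs_self M)⟩

namespace LocBdd

variable {p q : ℝ → ℝ}

lemma add (hp : LocBdd p) (hq : LocBdd q) : LocBdd (fun t => p t + q t) where
  measurable := hp.measurable.add hq.measurable
  bound T := by
    obtain ⟨M, hM0, hM⟩ := hp.bound T
    obtain ⟨N, hN0, hN⟩ := hq.bound T
    exact ⟨M + N, by positivity,
      fun t ht => (abs_add_le _ _).trans (add_le_add (hM t ht) (hN t ht))⟩

lemma const_mul (hp : LocBdd p) (c : ℝ) : LocBdd (fun t => c * p t) where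
  measurable := hp.measurable.const_mul c
  bound T := by
    obtain ⟨M, hM0, hM⟩ := hp.bound T
    exact ⟨|c| * M, by positivity, fun t ht => by
      rw [abs_mul]; exact mul_le_mul_of_nonneg_left (hM t ht) (abs_nonneg _)⟩

lemma sub (hp : LocBdd p) (hq : LocBdd q) : LocBdd (fun t => p t - q t) := by
  simpa [sub_eq_add_neg] using hp.add (hq.const_mul (-1))

end LocBdd

/-- The Riemann-Liouville integral of order `a > 0` based at `0`; it vanishes for `t ≤ 0`. -/
noncomputable def rlInt (a : ℝ) (p : ℝ → ℝ) (t : ℝ) : ℝ :=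
  ∫ s in Ioc 0 t, (t - s) ^ (a - 1) / Real.Gamma a * p s

section rlInt

variable {a b t : ℝ} {p q : ℝ → ℝ}

lemma rlInt_of_nonpos (ht : t ≤ 0) : rlInt a p t = 0 := by
  simp [rlInt, Ioc_eq_empty_of_le ht]

lemma rlInt_integrableOn (ha : 0 < a) (hp : LocBdd p) {c : ℝ} (hc : 0 ≤ c) (t T : ℝ) :
    IntegrableOn (fun s => (T - s) ^ (a - 1) / Real.Gamma a * p s) (Ioc c (min t T)) := by
  obtain ⟨M, -, hM⟩ := hp.bound T
  refine Integrable.mul_bdd (c := M)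
    (((integrableOn_sub_rpow ha c T).mono_set (Ioc_subset_Ioc_right (min_le_right _ _))).div_const _)
    hp.measurable.aestronglyMeasurable ?_
  filter_upwards [ae_restrict_mem measurableSet_Ioc] with s hs
  exact hM s ⟨hc.trans hs.1.le, hs.2.trans (min_le_right _ _)⟩

lemma rlInt_integrableOn' (ha : 0 < a) (hp : LocBdd p) (t : ℝ) :
    IntegrableOn (fun s => (t - s) ^ (a - 1) / Real.Gamma a * p s) (Ioc 0 t) := by
  simpa using rlInt_integrableOn ha hp le_rfl t t

lemma rlInt_congr (h : ∀ s ∈ Ioo 0 t, p s = q s) : rlInt a p t = rlInt a q t := by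
  simp only [rlInt, integral_Ioc_eq_integral_Ioo]
  exact setIntegral_congr_fun measurableSet_Ioo fun s hs => by rw [h s hs]

lemma kernel_nonneg (ha : 0 < a) {x : ℝ} (hx : 0 ≤ x) : 0 ≤ x ^ (a - 1) / Real.Gamma a :=
  div_nonneg (Real.rpow_nonneg hx _) (Real.Gamma_pos_of_pos ha).le

lemma rlInt_mono (ha : 0 < a) (hp : LocBdd p) (hq : LocBdd q)
    (h : ∀ s ∈ Ioc 0 t, p s ≤ q s) : rlInt a p t ≤ rlInt a q t :=
  setIntegral_mono_on (rlInt_integrableOn' ha hp t) (rlInt_integrableOn' ha hq t) measurableSet_Ioc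
    fun s hs => mul_le_mul_of_nonneg_left (h s hs) (kernel_nonneg ha (sub_nonneg.2 hs.2))

lemma rlInt_nonneg (ha : 0 < a) (h : ∀ s ∈ Ioc 0 t, 0 ≤ p s) : 0 ≤ rlInt a p t :=
  setIntegral_nonneg measurableSet_Ioc
    fun s hs => mul_nonneg (kernel_nonneg ha (sub_nonneg.2 hs.2)) (h s hs)

lemma rlInt_add (ha : 0 < a) (hp : LocBdd p) (hq : LocBdd q) :
    rlInt a (fun s => p s + q s) t = rlInt a p t + rlInt a q t := by
  simp only [rlInt, mul_add]
  exact integral_add (rlInt_integrableOn' ha hp t) (rlInt_integrableOn' ha hq t)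

lemma rlInt_const_mul (c : ℝ) : rlInt a (fun s => c * p s) t = c * rlInt a p t := by
  simp only [rlInt, ← integral_const_mul]
  congr 1
  ext s
  ring

lemma rlInt_sub (ha : 0 < a) (hp : LocBdd p) (hq : LocBdd q) :
    rlInt a (fun s => p s - q s) t = rlInt a p t - rlInt a q t := by
  simp only [rlInt, mul_sub]
  exact integral_sub (rlInt_integrableOn' ha hp t) (rlInt_integrableOn' ha hq t)

lemma abs_rlInt_le (ha : 0 < a) (hp : LocBdd p) (hq : LocBdd q)
    (h : ∀ s ∈ Ioc 0 t, |p s| ≤ q s) : |rlInt a p t| ≤ rlInt a q t := by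
  rw [abs_le]
  constructor
  · have := rlInt_mono (t := t) ha (hq.const_mul (-1)) hp
      (fun s hs => by linarith [(abs_le.1 (h s hs)).1])
    rw [rlInt_const_mul] at this
    linarith
  · exact rlInt_mono ha hp hq fun s hs => (le_abs_self _).trans (h s hs)

lemma rlInt_rpow (ha : 0 < a) (hb : 0 ≤ b) (ht : 0 ≤ t) :
    rlInt a (fun s => s ^ b) t = Real.Gamma (b + 1) / Real.Gamma (a + b + 1) * t ^ (a + b) := by
  rcases ht.eq_or_lt with rfl | ht
  · rw [rlInt_of_nonpos le_rfl, Real.zero_rpow (by linarith), mul_zero]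
  have h := setIntegral_sub_rpow_mul_sub_rpow ha (show 0 < b + 1 by linarith) ht
  have e : rlInt a (fun s => s ^ b) t
      = (∫ x in Ioc 0 t, (t - x) ^ (a - 1) * (x - 0) ^ (b + 1 - 1)) / Real.Gamma a := by
    rw [rlInt, ← integral_div]
    congr 1
    ext x
    rw [sub_zero, add_sub_cancel_right]
    ring
  have := (Real.Gamma_pos_of_pos ha).ne'
  rw [e, h, ProbabilityTheory.beta, sub_zero, ← add_assoc, add_sub_cancel_right]
  field_simp

lemma rlInt_const (ha : 0 < a) (c : ℝ) (ht : 0 ≤ t) :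
    rlInt a (fun _ => c) t = c * (t ^ a / Real.Gamma (a + 1)) := by
  have h := rlInt_rpow ha le_rfl ht
  have e : rlInt a (fun _ => c) t = c * rlInt a (fun s => s ^ (0 : ℝ)) t := by
    rw [← rlInt_const_mul]
    simp
  rw [e, h]
  simp only [zero_add, add_zero, Real.Gamma_one]
  ring

lemma rlInt_one_eq : rlInt 1 p t = ∫ s in Ioc 0 t, p s := by simp [rlInt]

/-- Hölder continuity of the Riemann-Liouville integral of a bounded function. -/
lemma abs_rlInt_sub_rlInt_le (ha : 0 < a) (ha1 : a ≤ 1) (hp : LocBdd p) {t T M : ℝ} (ht : 0 ≤ t)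
    (htT : t ≤ T) (hM : ∀ s ∈ Icc 0 T, |p s| ≤ M) :
    |rlInt a p T - rlInt a p t| ≤ 2 * M / Real.Gamma (a + 1) * (T - t) ^ a := by
  set κ : ℝ → ℝ := fun x => x ^ (a - 1) / Real.Gamma a with hκ
  have hM0 : 0 ≤ M := (abs_nonneg _).trans (hM 0 ⟨le_rfl, ht.trans htT⟩)
  have hi1 : IntegrableOn (fun s => κ (T - s) * p s) (Ioc 0 t) := by
    simpa [min_eq_left htT] using rlInt_integrableOn ha hp le_rfl t T
  have hi2 : IntegrableOn (fun s => κ (T - s) * p s) (Ioc t T) := by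
    simpa using rlInt_integrableOn ha hp ht T T
  have hi3 : IntegrableOn (fun s => κ (t - s) * p s) (Ioc 0 t) := rlInt_integrableOn' ha hp t
  have hk1 : IntegrableOn (fun s => κ (T - s)) (Ioc 0 t) :=
    ((integrableOn_sub_rpow ha 0 T).mono_set (Ioc_subset_Ioc_right htT)).div_const _
  have hk2 : IntegrableOn (fun s => κ (T - s)) (Ioc t T) :=
    (integrableOn_sub_rpow ha t T).div_const _
  have hk3 : IntegrableOn (fun s => κ (t - s)) (Ioc 0 t) :=
    (integrableOn_sub_rpow ha 0 t).div_const _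
  have hval : ∀ c T : ℝ, c ≤ T → ∫ s in Ioc c T, κ (T - s) = (T - c) ^ a / Real.Gamma (a + 1) := by
    intro c T h
    rw [integral_div, setIntegral_sub_rpow ha h, Real.Gamma_add_one ha.ne', div_div]
  have hsplit : ∫ s in Ioc 0 t, κ (T - s) = (T ^ a - (T - t) ^ a) / Real.Gamma (a + 1) := by
    have h := setIntegral_union (Ioc_disjoint_Ioc_of_le le_rfl) measurableSet_Ioc hk1 hk2
    rw [Ioc_union_Ioc_eq_Ioc ht htT, hval 0 T (ht.trans htT), hval t T htT, sub_zero] at h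
    rw [sub_div]; linarith
  have hdec : rlInt a p T = (∫ s in Ioc 0 t, κ (T - s) * p s) + ∫ s in Ioc t T, κ (T - s) * p s := by
    rw [rlInt, ← Ioc_union_Ioc_eq_Ioc ht htT]
    exact setIntegral_union (Ioc_disjoint_Ioc_of_le le_rfl) measurableSet_Ioc hi1 hi2
  have e : rlInt a p T - rlInt a p t = (∫ s in Ioc 0 t, (κ (T - s) - κ (t - s)) * p s)
      + ∫ s in Ioc t T, κ (T - s) * p s := by
    rw [hdec, show rlInt a p t = ∫ s in Ioc 0 t, κ (t - s) * p s from rfl]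
    simp only [sub_mul]
    rw [integral_sub hi1 hi3]
    ring
  have b1 : ‖∫ s in Ioc 0 t, (κ (T - s) - κ (t - s)) * p s‖
      ≤ ∫ s in Ioc 0 t, (κ (t - s) - κ (T - s)) * M := by
    -- the kernel decreases in time only off `s = t`, where `0 ^ (a - 1) = 0` for `a ≠ 1`
    rw [integral_Ioc_eq_integral_Ioo, integral_Ioc_eq_integral_Ioo]
    refine norm_integral_le_of_norm_le
      (((hk3.sub hk1).mono_set Ioo_subset_Ioc_self).mul_const M) ?_
    filter_upwards [ae_restrict_mem measurableSet_Ioo] with s hs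
    have h1 : κ (T - s) ≤ κ (t - s) :=
      div_le_div_of_nonneg_right (Real.rpow_le_rpow_of_nonpos (sub_pos.2 hs.2) (by linarith)
        (by linarith)) (Real.Gamma_pos_of_pos ha).le
    rw [Real.norm_eq_abs, abs_mul, abs_of_nonpos (sub_nonpos.2 h1), neg_sub]
    exact mul_le_mul_of_nonneg_left (hM s ⟨hs.1.le, hs.2.le.trans htT⟩) (sub_nonneg.2 h1)
  have b2 : ‖∫ s in Ioc t T, κ (T - s) * p s‖ ≤ ∫ s in Ioc t T, κ (T - s) * M := by
    refine norm_integral_le_of_norm_le (hk2.mul_const M) ?_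
    filter_upwards [ae_restrict_mem measurableSet_Ioc] with s hs
    have h1 : 0 ≤ κ (T - s) := kernel_nonneg ha (sub_nonneg.2 hs.2)
    rw [Real.norm_eq_abs, abs_mul, abs_of_nonneg h1]
    exact mul_le_mul_of_nonneg_left (hM s ⟨ht.trans hs.1.le, hs.2⟩) h1
  rw [integral_mul_const, integral_sub hk3 hk1, hval 0 t ht, hsplit, sub_zero] at b1
  rw [integral_mul_const, hval t T htT] at b2
  have hmono : t ^ a ≤ T ^ a := Real.rpow_le_rpow ht htT ha.le
  have hΓ : 0 < Real.Gamma (a + 1) := Real.Gamma_pos_of_pos (by linarith)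
  rw [e]
  refine (abs_add_le _ _).trans ((add_le_add b1 b2).trans ?_)
  have : (t ^ a / Real.Gamma (a + 1) - (T ^ a - (T - t) ^ a) / Real.Gamma (a + 1)) * M
      + (T - t) ^ a / Real.Gamma (a + 1) * M
      = 2 * M / Real.Gamma (a + 1) * (T - t) ^ a - (T ^ a - t ^ a) * M / Real.Gamma (a + 1) := by
    ring
  rw [this]
  have : 0 ≤ (T ^ a - t ^ a) * M / Real.Gamma (a + 1) :=
    div_nonneg (mul_nonneg (sub_nonneg.2 hmono) hM0) hΓ.le
  linarith

lemma rlInt_max_zero (t : ℝ) : rlInt a p (max t 0) = rlInt a p t := by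
  rcases le_total t 0 with h | h
  · rw [max_eq_right h, rlInt_of_nonpos le_rfl, rlInt_of_nonpos h]
  · rw [max_eq_left h]

lemma continuous_rlInt (ha : 0 < a) (ha1 : a ≤ 1) (hp : LocBdd p) : Continuous (rlInt a p) := by
  rw [continuous_iff_continuousAt]
  intro x
  obtain ⟨M, hM0, hM⟩ := hp.bound (max (x + 1) 0)
  have key : ∀ s t : ℝ, s ≤ t → t ≤ x + 1 →
      |rlInt a p t - rlInt a p s| ≤ 2 * M / Real.Gamma (a + 1) * |t - s| ^ a := by
    intro s t hst htx
    rw [← rlInt_max_zero t, ← rlInt_max_zero s]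
    have h1 : max s 0 ≤ max t 0 := max_le_max_right 0 hst
    refine (abs_rlInt_sub_rlInt_le ha ha1 hp (le_max_right s 0) h1
      (fun r hr => hM r ⟨hr.1, hr.2.trans (max_le_max_right 0 htx)⟩)).trans ?_
    refine mul_le_mul_of_nonneg_left (Real.rpow_le_rpow (sub_nonneg.2 h1) ?_ ha.le)
      (div_nonneg (by positivity) (Real.Gamma_pos_of_pos (by linarith)).le)
    exact (le_abs_self _).trans (abs_max_sub_max_le_abs t s 0)
  have hlim : Tendsto (fun s => 2 * M / Real.Gamma (a + 1) * |s - x| ^ a) (𝓝 x) (𝓝 0) := by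
    have h : Continuous fun s : ℝ => 2 * M / Real.Gamma (a + 1) * |s - x| ^ a :=
      continuous_const.mul ((continuous_id.sub continuous_const).abs.rpow_const
        fun _ => Or.inr ha.le)
    have h2 := h.tendsto x
    simpa [Real.zero_rpow ha.ne'] using h2
  refine tendsto_iff_dist_tendsto_zero.2 (squeeze_zero' (Eventually.of_forall fun _ => dist_nonneg)
    ?_ hlim)
  filter_upwards [Iio_mem_nhds (show x < x + 1 by linarith)] with s hs
  rw [Real.dist_eq]
  rcases le_total s x with h | h
  · rw [abs_sub_comm, abs_sub_comm s x]
    exact key s x h (by linarith)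
  · exact key x s h (le_of_lt hs)

lemma locBdd_rlInt (ha : 0 < a) (ha1 : a ≤ 1) (hp : LocBdd p) : LocBdd (rlInt a p) :=
  (continuous_rlInt ha ha1 hp).locBdd

/-- The semigroup property of the Riemann-Liouville integrals. -/
lemma rlInt_rlInt (ha : 0 < a) (hb : 0 < b) (hp : LocBdd p) :
    rlInt a (rlInt b p) t = rlInt (a + b) p t := by
  obtain ⟨M, -, hM⟩ := hp.bound t
  have hΓa := (Real.Gamma_pos_of_pos ha).ne'
  have hΓb := (Real.Gamma_pos_of_pos hb).ne'
  refine setIntegral_triangle_swap (M := M) (K := fun τ => (t - τ) ^ (a - 1) / Real.Gamma a)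
    (k := fun x => x ^ (b - 1) / Real.Gamma b) (by fun_prop) (by fun_prop) hp.measurable
    (fun τ hτ => kernel_nonneg ha (sub_nonneg.2 hτ.2)) (fun x hx => kernel_nonneg hb hx.le)
    (fun s hs => hM s ⟨hs.1.le, hs.2⟩) (fun s hs => ?_) (fun s hs => ?_)
    ((integrableOn_sub_rpow (add_pos ha hb) 0 t).div_const _)
  · refine ((integrableOn_sub_rpow_mul_sub_rpow ha hb hs.2).div_const
      (Real.Gamma a * Real.Gamma b)).congr (Eventually.of_forall fun x => ?_)
    simp only
    field_simp
  · have h := setIntegral_sub_rpow_mul_sub_rpow ha hb hs.2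
    have e : ∀ τ : ℝ, (t - τ) ^ (a - 1) / Real.Gamma a * ((τ - s) ^ (b - 1) / Real.Gamma b)
        = (t - τ) ^ (a - 1) * (τ - s) ^ (b - 1) / (Real.Gamma a * Real.Gamma b) := by
      intro τ; field_simp
    simp only [e]
    rw [integral_div, h, ProbabilityTheory.beta]
    field_simp

/-- The Riemann-Liouville integral of an exponential: the gain `c ^ (-a)` makes the integral
operators contractions in an exponentially weighted norm. -/
lemma rlInt_exp_le (ha : 0 < a) {c : ℝ} (hc : 0 < c) (t : ℝ) :
    rlInt a (fun s => Real.exp (c * s)) t ≤ (1 / c) ^ a * Real.exp (c * t) := by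
  rcases le_or_gt t 0 with ht | ht
  · rw [rlInt_of_nonpos ht]; positivity
  have hΓ := Real.Gamma_pos_of_pos ha
  have h0 := Real.integral_rpow_mul_exp_neg_mul_Ioi ha hc
  have hi : IntegrableOn (fun x : ℝ => x ^ (a - 1) * Real.exp (-(c * x))) (Ioi 0) := by
    refine Integrable.of_integral_ne_zero ?_
    rw [h0]; positivity
  have e : rlInt a (fun s => Real.exp (c * s)) t
      = Real.exp (c * t) / Real.Gamma a
        * ∫ x in Ioc 0 t, x ^ (a - 1) * Real.exp (-(c * x)) := by
    rw [rlInt, ← intervalIntegral.integral_of_le ht.le, ← intervalIntegral.integral_of_le ht.le]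
    have := intervalIntegral.integral_comp_sub_left (a := 0) (b := t)
      (fun x : ℝ => x ^ (a - 1) * Real.exp (-(c * x))) t
    rw [sub_self, sub_zero] at this
    rw [← this, ← intervalIntegral.integral_const_mul]
    refine intervalIntegral.integral_congr fun s _ => ?_
    have : Real.exp (c * s) = Real.exp (c * t) * Real.exp (-(c * (t - s))) := by
      rw [← Real.exp_add]; congr 1; ring
    rw [this]
    ring
  have hle : ∫ x in Ioc 0 t, x ^ (a - 1) * Real.exp (-(c * x)) ≤ (1 / c) ^ a * Real.Gamma a := by
    rw [← h0]
    refine setIntegral_mono_set hi ?_ Ioc_subset_Ioi_self.eventuallyLE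
    filter_upwards [ae_restrict_mem measurableSet_Ioi] with x hx
    exact mul_nonneg (Real.rpow_nonneg (le_of_lt hx) _) (Real.exp_pos _).le
  rw [e]
  calc _ ≤ Real.exp (c * t) / Real.Gamma a * ((1 / c) ^ a * Real.Gamma a) :=
        mul_le_mul_of_nonneg_left hle (by positivity)
    _ = _ := by field_simp

end rlInt

/-! ### Volterra equations in an exponentially weighted norm -/

/-- Existence of a solution of `w = N w` on `[0, T]` for an operator that contracts the norm
`sup |w t| exp (-c t)`. -/
lemma exists_fixedPoint_of_weighted_contraction {T c q : ℝ} (hT : 0 ≤ T) (hq0 : 0 ≤ q) (hq : q < 1)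
    (N : (ℝ → ℝ) → ℝ → ℝ) (hN : ∀ w, Continuous w → ContinuousOn (N w) (Icc 0 T))
    (hlip : ∀ w₁ w₂, Continuous w₁ → Continuous w₂ → ∀ K, 0 ≤ K →
      (∀ t ∈ Icc 0 T, |w₁ t - w₂ t| ≤ K * Real.exp (c * t)) →
      ∀ t ∈ Icc 0 T, |N w₁ t - N w₂ t| ≤ q * K * Real.exp (c * t)) :
    ∃ w, Continuous w ∧ ∀ t ∈ Icc 0 T, w t = N w t := by
  -- the unknown is `ω t = w t * exp (-c t)`, for which the norm is the sup norm
  set E : C(Icc (0 : ℝ) T, ℝ) → ℝ → ℝ := fun ω t => IccExtend hT ω t * Real.exp (c * t) with hE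
  have hEc : ∀ ω, Continuous (E ω) := fun ω =>
    (ω.continuous.Icc_extend').mul (Real.continuous_exp.comp (continuous_const.mul continuous_id))
  have hcont : ∀ ω, Continuous fun t : Icc (0 : ℝ) T => N (E ω) t * Real.exp (-(c * t)) :=
    fun ω => ((hN _ (hEc ω)).domRestrict).mul (by fun_prop)
  set F : C(Icc (0 : ℝ) T, ℝ) → C(Icc (0 : ℝ) T, ℝ) :=
    fun ω => ⟨fun t => N (E ω) t * Real.exp (-(c * t)), hcont ω⟩ with hF
  have hFc : ContractingWith ⟨q, hq0⟩ F := by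
    refine ⟨by exact_mod_cast hq, LipschitzWith.of_dist_le_mul fun ω₁ ω₂ => ?_⟩
    rw [ContinuousMap.dist_le (by positivity)]
    intro t
    have h1 : ∀ s ∈ Icc 0 T, |E ω₁ s - E ω₂ s| ≤ dist ω₁ ω₂ * Real.exp (c * s) := by
      intro s hs
      simp only [hE, IccExtend_of_mem hT _ hs]
      rw [← sub_mul, abs_mul, Real.abs_exp]
      exact mul_le_mul_of_nonneg_right (ContinuousMap.dist_apply_le_dist (f := ω₁) (g := ω₂) _)
        (Real.exp_pos _).le
    have h2 := hlip _ _ (hEc ω₁) (hEc ω₂) _ dist_nonneg h1 t t.2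
    have e : F ω₁ t - F ω₂ t = (N (E ω₁) t - N (E ω₂) t) * Real.exp (-(c * t)) := by
      simp only [hF, ContinuousMap.coe_mk]; ring
    rw [Real.dist_eq, e, abs_mul, Real.abs_exp]
    refine (mul_le_mul_of_nonneg_right h2 (Real.exp_pos _).le).trans (le_of_eq ?_)
    rw [mul_assoc, ← Real.exp_add, add_neg_cancel, Real.exp_zero, mul_one]
    rfl
  have hfix := hFc.fixedPoint_isFixedPt
  set ω := ContractingWith.fixedPoint F hFc
  refine ⟨E ω, hEc ω, fun t ht => ?_⟩
  have h := congrArg (fun ω : C(Icc (0 : ℝ) T, ℝ) => ω ⟨t, ht⟩) hfix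
  simp only [hF, ContinuousMap.coe_mk] at h
  simp only [hE, IccExtend_of_mem hT _ ht]
  rw [← h, mul_assoc, ← Real.exp_add, neg_add_cancel, Real.exp_zero, mul_one]

lemma eq_zero_of_weighted_contraction {T c q : ℝ} (hq0 : 0 ≤ q) (hq : q < 1) {e : ℝ → ℝ}
    (he : Continuous e)
    (h : ∀ K, 0 ≤ K → (∀ t ∈ Icc 0 T, |e t| ≤ K * Real.exp (c * t)) →
      ∀ t ∈ Icc 0 T, |e t| ≤ q * K * Real.exp (c * t)) :
    ∀ t ∈ Icc 0 T, e t = 0 := by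
  obtain ⟨M, hM⟩ := isCompact_Icc.exists_bound_of_continuousOn (s := Icc 0 T)
    (f := fun t => e t * Real.exp (-(c * t))) (by fun_prop)
  have hit : ∀ j : ℕ, ∀ t ∈ Icc 0 T, |e t| ≤ q ^ j * |M| * Real.exp (c * t) := by
    intro j
    induction j with
    | zero =>
      intro t ht
      have := (hM t ht).trans (le_abs_self M)
      rw [Real.norm_eq_abs, abs_mul, Real.abs_exp, Real.exp_neg, ← div_eq_mul_inv,
        div_le_iff₀ (Real.exp_pos _)] at this
      simpa using this
    | succ j ih =>
      intro t ht
      have := h _ (by positivity) ih t ht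
      rwa [← mul_assoc, ← pow_succ'] at this
  intro t ht
  have hlim : Tendsto (fun j : ℕ => q ^ j * |M| * Real.exp (c * t)) atTop (𝓝 0) := by
    simpa using ((tendsto_pow_atTop_nhds_zero_of_lt_one hq0 hq).mul_const |M|).mul_const
      (Real.exp (c * t))
  exact abs_nonpos_iff.1 (ge_of_tendsto' hlim fun j => hit j t ht)

lemma tendsto_one_div_rpow {a : ℝ} (ha : 0 < a) :
    Tendsto (fun c : ℝ => (1 / c) ^ a) atTop (𝓝 0) := by
  refine (tendsto_rpow_neg_atTop ha).congr' ?_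
  filter_upwards [eventually_ge_atTop 0] with c hc
  rw [Real.rpow_neg hc, one_div, Real.inv_rpow hc]

lemma abs_rlInt_le_of_abs_le_exp {a c K T : ℝ} (ha : 0 < a) (hc : 0 < c) (hK : 0 ≤ K)
    {p : ℝ → ℝ} (hp : LocBdd p) (h : ∀ t ∈ Icc 0 T, |p t| ≤ K * Real.exp (c * t)) {t : ℝ}
    (ht : t ∈ Icc 0 T) : |rlInt a p t| ≤ (1 / c) ^ a * K * Real.exp (c * t) := by
  have hexp : LocBdd fun s => Real.exp (c * s) := (by fun_prop : Continuous _).locBdd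
  refine (abs_rlInt_le ha hp (hexp.const_mul K)
    fun s hs => h s ⟨hs.1.le, hs.2.trans ht.2⟩).trans ?_
  rw [rlInt_const_mul]
  calc _ ≤ K * ((1 / c) ^ a * Real.exp (c * t)) :=
        mul_le_mul_of_nonneg_left (rlInt_exp_le ha hc t) hK
    _ = _ := by ring

section Linear

variable {a ϱ T : ℝ}

lemma exists_weight (ha : 0 < a) (ϱ : ℝ) : ∃ c : ℝ, 0 < c ∧ |ϱ| * (1 / c) ^ a ≤ 1 / 2 := by
  have h := (tendsto_one_div_rpow ha).const_mul |ϱ|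
  rw [mul_zero] at h
  have h1 := h.eventually (Iic_mem_nhds (show (0 : ℝ) < 1 / 2 by norm_num))
  obtain ⟨c, hc, hc0⟩ := (h1.and (eventually_gt_atTop 0)).exists
  exact ⟨c, hc0, hc⟩

lemma exists_linear_volterra (ha : 0 < a) (ha1 : a ≤ 1) (hT : 0 ≤ T) (ϱ : ℝ) {g : ℝ → ℝ}
    (hg : Continuous g) :
    ∃ u, Continuous u ∧ ∀ t ∈ Icc 0 T, u t + ϱ * rlInt a u t = g t := by
  obtain ⟨c, hc0, hc⟩ := exists_weight ha ϱ
  obtain ⟨u, hu, h⟩ := exists_fixedPoint_of_weighted_contraction (c := c) (q := 1 / 2) hT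
    (by norm_num) (by norm_num) (fun w t => g t - ϱ * rlInt a w t)
    (fun w hw => (hg.sub (continuous_const.mul (continuous_rlInt ha ha1 hw.locBdd))).continuousOn)
    (fun w₁ w₂ h₁ h₂ K hK hw t ht => by
      have h := abs_rlInt_le_of_abs_le_exp ha hc0 hK (h₁.sub h₂).locBdd hw ht
      change |rlInt a (fun s => w₁ s - w₂ s) t| ≤ _ at h
      rw [rlInt_sub ha h₁.locBdd h₂.locBdd] at h
      calc |g t - ϱ * rlInt a w₁ t - (g t - ϱ * rlInt a w₂ t)|
          = |ϱ| * |rlInt a w₁ t - rlInt a w₂ t| := by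
            rw [← abs_mul, ← abs_neg]; congr 1; ring
        _ ≤ |ϱ| * ((1 / c) ^ a * K * Real.exp (c * t)) :=
            mul_le_mul_of_nonneg_left h (abs_nonneg _)
        _ = |ϱ| * (1 / c) ^ a * (K * Real.exp (c * t)) := by ring
        _ ≤ 1 / 2 * (K * Real.exp (c * t)) := mul_le_mul_of_nonneg_right hc (by positivity)
        _ = _ := by ring)
  exact ⟨u, hu, fun t ht => by rw [h t ht]; ring⟩

lemma eq_zero_of_linear_volterra (ha : 0 < a) {e : ℝ → ℝ} (he : Continuous e)
    (h : ∀ t ∈ Icc 0 T, e t + ϱ * rlInt a e t = 0) : ∀ t ∈ Icc 0 T, e t = 0 := by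
  obtain ⟨c, hc0, hc⟩ := exists_weight ha ϱ
  refine eq_zero_of_weighted_contraction (c := c) (q := 1 / 2) (by norm_num) (by norm_num) he
    fun K hK hK' t ht => ?_
  have h1 := abs_rlInt_le_of_abs_le_exp ha hc0 hK he.locBdd hK' ht
  calc |e t| = |ϱ| * |rlInt a e t| := by
        rw [← abs_mul, ← abs_neg]; congr 1; linarith [h t ht]
    _ ≤ |ϱ| * ((1 / c) ^ a * K * Real.exp (c * t)) := mul_le_mul_of_nonneg_left h1 (abs_nonneg _)
    _ = |ϱ| * (1 / c) ^ a * (K * Real.exp (c * t)) := by ring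
    _ ≤ 1 / 2 * (K * Real.exp (c * t)) := mul_le_mul_of_nonneg_right hc (by positivity)
    _ = _ := by ring

end Linear

/-! ### Positivity of the fractional relaxation equation -/

/-- The substitution `y = x (b - a) / (a (b - x))` turns this integral into a Beta integral. -/
lemma setIntegral_balayage {α a b : ℝ} (hα : 0 < α) (hα1 : α < 1) (ha : 0 < a) (hab : a < b) :
    ∫ x in Ioc 0 a, (a - x) ^ (-α) / (b - x) * x ^ (α - 1)
      = ProbabilityTheory.beta α (1 - α) * (b ^ (α - 1) * (b - a) ^ (-α)) := by
  have hb : 0 < b := ha.trans hab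
  have hba : 0 < b - a := sub_pos.2 hab
  have hB := setIntegral_rpow_mul_sub_rpow hα (show 0 < 1 - α by linarith) one_pos
  rw [Real.one_rpow, one_mul, integral_Ioc_eq_integral_Ioo] at hB
  set y : ℝ → ℝ := fun x => x * (b - a) / (a * (b - x)) with hy
  set y' : ℝ → ℝ := fun x => b * (b - a) / (a * (b - x) ^ 2) with hy'
  have h1y : ∀ x ∈ Ioo 0 a, 1 - y x = b * (a - x) / (a * (b - x)) := by
    intro x hx
    have : b - x ≠ 0 := by linarith [hx.2]
    simp only [hy]
    field_simp
    ring
  have himage : y '' Ioo 0 a = Ioo 0 1 := by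
    ext z
    constructor
    · rintro ⟨x, hx, rfl⟩
      have hbx : 0 < b - x := by linarith [hx.2]
      have hax : 0 < a - x := by linarith [hx.2]
      have hx0 := hx.1
      refine ⟨by simp only [hy]; positivity, ?_⟩
      have : 0 < 1 - y x := by rw [h1y x hx]; positivity
      linarith
    · rintro ⟨hz0, hz1⟩
      have hd : 0 < b - a + a * z := by positivity
      refine ⟨a * b * z / (b - a + a * z), ⟨by positivity, ?_⟩, ?_⟩
      · rw [div_lt_iff₀ hd]
        nlinarith [mul_pos (mul_pos ha hba) (sub_pos.2 hz1)]
      · simp only [hy]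
        have : b - a * b * z / (b - a + a * z) = b * (b - a) / (b - a + a * z) := by
          field_simp; ring
        rw [this]
        field_simp
  have hderiv : ∀ x ∈ Ioo 0 a, HasDerivWithinAt y (y' x) (Ioo 0 a) x := by
    intro x hx
    have hbx : b - x ≠ 0 := by linarith [hx.2]
    have h1 : HasDerivAt (fun x => x * (b - a)) (1 * (b - a)) x := (hasDerivAt_id x).mul_const _
    have h2 : HasDerivAt (fun x => a * (b - x)) (a * (-1)) x :=
      ((hasDerivAt_id x).const_sub b).const_mul a
    have h3 := (h1.div h2 (mul_ne_zero ha.ne' hbx)).hasDerivWithinAt (s := Ioo 0 a)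
    refine h3.congr_deriv ?_
    simp only [hy']
    field_simp
    ring
  have hinj : InjOn y (Ioo 0 a) := by
    intro x hx x' hx' h
    have hbx : b - x ≠ 0 := by linarith [hx.2]
    have hbx' : b - x' ≠ 0 := by linarith [hx'.2]
    simp only [hy] at h
    rw [div_eq_div_iff (mul_ne_zero ha.ne' hbx) (mul_ne_zero ha.ne' hbx')] at h
    have : (a * b * (b - a)) * (x - x') = 0 := by linear_combination h
    have h2 := (mul_eq_zero.1 this).resolve_left (by positivity)
    linarith
  have hcv := integral_image_eq_integral_abs_deriv_smul measurableSet_Ioo hderiv hinj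
    (fun x => x ^ (α - 1) * (1 - x) ^ (1 - α - 1))
  rw [himage, hB] at hcv
  have hpt : ∀ x ∈ Ioo 0 a, |y' x| • ((y x) ^ (α - 1) * (1 - y x) ^ (1 - α - 1))
      = (b ^ (1 - α) * (b - a) ^ α) * ((a - x) ^ (-α) / (b - x) * x ^ (α - 1)) := by
    intro x hx
    have hbx : 0 < b - x := by linarith [hx.2]
    have hax : 0 < a - x := by linarith [hx.2]
    have hx0 : 0 < x := hx.1
    have hy'0 : 0 < y' x := by simp only [hy']; positivity
    rw [h1y x hx, abs_of_pos hy'0, smul_eq_mul]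
    simp only [hy, hy']
    rw [show 1 - α - 1 = -α by ring, Real.rpow_sub_one (by positivity), Real.rpow_sub_one hx0.ne',
      Real.rpow_neg (by positivity), Real.rpow_neg hax.le, Real.rpow_sub hb, Real.rpow_one,
      Real.div_rpow (by positivity) (by positivity), Real.div_rpow (by positivity) (by positivity),
      Real.mul_rpow hx0.le hba.le, Real.mul_rpow hb.le hax.le]
    have := (Real.rpow_pos_of_pos hx0 α).ne'
    have := (Real.rpow_pos_of_pos hax α).ne'
    have := (Real.rpow_pos_of_pos hb α).ne'
    have := (Real.rpow_pos_of_pos hba α).ne'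
    have : (a * (b - x)) ^ α ≠ 0 := (Real.rpow_pos_of_pos (by positivity) α).ne'
    field_simp
  rw [setIntegral_congr_fun measurableSet_Ioo hpt, integral_const_mul] at hcv
  rw [hcv, integral_Ioc_eq_integral_Ioo]
  have h1 : b ^ (α - 1) * b ^ (1 - α) = 1 := by
    rw [← Real.rpow_add hb]; simp
  have h2 : (b - a) ^ (-α) * (b - a) ^ α = 1 := by
    rw [← Real.rpow_add hba]; simp
  linear_combination (-(∫ x in Ioo 0 a, (a - x) ^ (-α) / (b - x) * x ^ (α - 1)))
    * (h1 * (b - a) ^ (-α) * (b - a) ^ α + h2)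

/-- If the Riemann-Liouville integral of `p` is nonnegative up to time `t₁`, then the past of `p`
up to `t₁` contributes nonnegatively at every later time `t₀`: the kernel seen from `t₀` is a
positive superposition of the kernels seen from times `τ ≤ t₁`. -/
lemma setIntegral_past_nonneg {α t₁ t₀ : ℝ} (hα : 0 < α) (hα1 : α < 1) (h10 : t₁ < t₀)
    {p : ℝ → ℝ} (hp : LocBdd p) (h : ∀ τ ∈ Icc 0 t₁, 0 ≤ rlInt α p τ) :
    0 ≤ ∫ s in Ioc 0 t₁, (t₀ - s) ^ (α - 1) / Real.Gamma α * p s := by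
  have hd : 0 < t₀ - t₁ := sub_pos.2 h10
  obtain ⟨M, -, hM⟩ := hp.bound t₁
  have hΓ := Real.Gamma_pos_of_pos hα
  set B := ProbabilityTheory.beta α (1 - α) with hBdef
  have hB : 0 < B := ProbabilityTheory.beta_pos hα (by linarith)
  have hval : ∀ s ∈ Ioo 0 t₁, ∫ τ in Ioc s t₁, (t₁ - τ) ^ (-α) / (t₀ - τ) *
      ((τ - s) ^ (α - 1) / Real.Gamma α)
        = B * (t₀ - t₁) ^ (-α) * ((t₀ - s) ^ (α - 1) / Real.Gamma α) := by
    intro s hs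
    have h1 := setIntegral_balayage hα hα1 (sub_pos.2 hs.2) (show t₁ - s < t₀ - s by linarith)
    rw [← intervalIntegral.integral_of_le (sub_pos.2 hs.2).le] at h1
    rw [← intervalIntegral.integral_of_le hs.2.le]
    have h2 := intervalIntegral.integral_comp_sub_right (a := s) (b := t₁)
      (fun x : ℝ => (t₁ - s - x) ^ (-α) / (t₀ - s - x) * x ^ (α - 1)) s
    rw [sub_self, h1] at h2
    simp only [sub_sub_sub_cancel_right] at h2
    simp only [← mul_div_assoc]
    rw [intervalIntegral.integral_div, h2]
    ring
  have hswap := setIntegral_triangle_swap (t := t₁) (M := M)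
    (K := fun τ => (t₁ - τ) ^ (-α) / (t₀ - τ)) (k := fun x => x ^ (α - 1) / Real.Gamma α)
    (G := fun s => B * (t₀ - t₁) ^ (-α) * ((t₀ - s) ^ (α - 1) / Real.Gamma α))
    (by fun_prop) (by fun_prop) hp.measurable
    (fun τ hτ => div_nonneg (Real.rpow_nonneg (sub_nonneg.2 hτ.2) _) (by linarith [hτ.2]))
    (fun x hx => kernel_nonneg hα hx.le) (fun s hs => hM s ⟨hs.1.le, hs.2⟩)
    (fun s hs => Integrable.of_integral_ne_zero (by
      rw [hval s hs]
      have : 0 < t₀ - s := by linarith [hs.2]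
      positivity))
    hval
    ((((integrableOn_sub_rpow hα 0 t₀).mono_set (Ioc_subset_Ioc_right h10.le)).div_const _).const_mul
      _)
  have hnn : 0 ≤ ∫ τ in Ioc 0 t₁, (t₁ - τ) ^ (-α) / (t₀ - τ) * rlInt α p τ :=
    setIntegral_nonneg measurableSet_Ioc fun τ hτ => mul_nonneg
      (div_nonneg (Real.rpow_nonneg (sub_nonneg.2 hτ.2) _) (by linarith [hτ.2]))
      (h τ ⟨hτ.1.le, hτ.2⟩)
  rw [show (∫ τ in Ioc 0 t₁, (t₁ - τ) ^ (-α) / (t₀ - τ) * rlInt α p τ) = _ from hswap] at hnn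
  simp only [mul_assoc] at hnn
  rw [integral_const_mul, integral_const_mul] at hnn
  exact nonneg_of_mul_nonneg_right (nonneg_of_mul_nonneg_right hnn hB)
    (Real.rpow_pos_of_pos hd _)

section Relaxation

variable {α ϱ T : ℝ}

/-- The maximum principle for `D^α u + ϱ u = h`, in integrated form and for a source bounded below
by a positive constant. -/
lemma relaxation_nonneg_of_pos (hα : 0 < α) (hα1 : α < 1) (hϱ : 0 < ϱ) {h u : ℝ → ℝ} {δ : ℝ}
    (hδ : 0 < δ) (hh : LocBdd h) (hhδ : ∀ t ∈ Ioc 0 T, δ ≤ h t) (hu : Continuous u)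
    (heq : ∀ t ∈ Icc 0 T, u t = rlInt α (fun s => h s - ϱ * u s) t) :
    ∀ t ∈ Icc 0 T, 0 ≤ u t := by
  rcases lt_or_ge T 0 with hT | hT
  · simp [Icc_eq_empty_of_lt hT]
  have hp : LocBdd fun s => h s - ϱ * u s := hh.sub (hu.locBdd.const_mul ϱ)
  set S : Set ℝ := {t | ∀ r : ℝ, 0 ≤ r → 0 ≤ u (min r t)} with hS
  have hSc : IsClosed S := by
    simp only [hS, ofPred_forall]
    exact isClosed_iInter fun r => isClosed_iInter fun _ =>
      isClosed_le continuous_const (hu.comp (continuous_const.min continuous_id))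
  have hS0 : (0 : ℝ) ∈ S := by
    intro r hr
    rw [min_eq_right hr, heq 0 ⟨le_rfl, hT⟩, rlInt_of_nonpos le_rfl]
  have hsub : Icc 0 T ⊆ S := by
    refine (hSc.inter isClosed_Icc).Icc_subset_of_forall_mem_nhdsWithin hS0 ?_
    rintro x ⟨hxS, hx0, hxT⟩
    have hpast : ∀ τ ∈ Icc 0 x, 0 ≤ u τ := fun τ hτ => by
      simpa [min_eq_left hτ.2] using hxS τ hτ.1
    -- it suffices to continue the inequality to the right of `x`
    suffices hev : ∀ᶠ t in 𝓝[>] x, ∀ s ∈ Ioc x t, 0 ≤ u s by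
      filter_upwards [hev, self_mem_nhdsWithin] with t ht hxt r hr
      rcases le_total (min r t) x with h1 | h1
      · exact hpast _ ⟨le_min hr (hx0.trans (le_of_lt hxt)), h1⟩
      · rcases h1.eq_or_lt with h2 | h2
        · rw [← h2]; exact hpast x ⟨hx0, le_rfl⟩
        · exact ht _ ⟨h2, min_le_right _ _⟩
    obtain ⟨η, hη, hball⟩ : ∃ η > x, (∀ s ∈ Ioo x η, 0 ≤ u s) ∨ (∀ s ∈ Ioo x η, u s < δ / ϱ) := by
      rcases lt_or_ge (u x) (δ / ϱ) with h1 | h1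
      · have := (hu.tendsto x).eventually (Iio_mem_nhds h1)
        obtain ⟨η, hη, h2⟩ := mem_nhdsGT_iff_exists_Ioo_subset.1 (this.filter_mono nhdsWithin_le_nhds)
        exact ⟨η, hη, Or.inr fun s hs => h2 hs⟩
      · have h2 : 0 < u x := (div_pos hδ hϱ).trans_le h1
        have := (hu.tendsto x).eventually (Ioi_mem_nhds h2)
        obtain ⟨η, hη, h2⟩ := mem_nhdsGT_iff_exists_Ioo_subset.1 (this.filter_mono nhdsWithin_le_nhds)
        exact ⟨η, hη, Or.inl fun s hs => (h2 hs).le⟩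
    filter_upwards [Ioo_mem_nhdsGT hη, Ioo_mem_nhdsGT hxT] with t ht htT s hs
    rcases hball with hball | hball
    · exact hball s ⟨hs.1, hs.2.trans_lt ht.2⟩
    have hsT : s ≤ T := hs.2.trans htT.2.le
    rw [heq s ⟨hx0.trans hs.1.le, hsT⟩, rlInt, ← Ioc_union_Ioc_eq_Ioc hx0 hs.1.le,
      setIntegral_union (Ioc_disjoint_Ioc_of_le le_rfl) measurableSet_Ioc
        (by simpa [min_eq_left hs.1.le] using rlInt_integrableOn hα hp le_rfl x s)
        (by simpa using rlInt_integrableOn hα hp hx0 s s)]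
    refine add_nonneg (setIntegral_past_nonneg hα hα1 hs.1 hp fun τ hτ => ?_)
      (setIntegral_nonneg measurableSet_Ioc fun r hr => mul_nonneg
        (kernel_nonneg hα (sub_nonneg.2 hr.2)) ?_)
    · rw [← heq τ ⟨hτ.1, hτ.2.trans hxT.le⟩]
      exact hpast τ hτ
    · have h1 := hball r ⟨hr.1, hr.2.trans_lt (hs.2.trans_lt ht.2)⟩
      have h2 := hhδ r ⟨hx0.trans_lt hr.1, hr.2.trans hsT⟩
      rw [lt_div_iff₀ hϱ] at h1
      linarith
  intro t ht
  simpa using hsub ht t ht.1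

/-- The maximum principle for `D^α u + ϱ u = h` with a nonnegative source. -/
lemma relaxation_nonneg (hα : 0 < α) (hα1 : α < 1) (hϱ : 0 < ϱ) {h u : ℝ → ℝ}
    (hh : LocBdd h) (hh0 : ∀ t ∈ Ioc 0 T, 0 ≤ h t) (hu : Continuous u)
    (heq : ∀ t ∈ Icc 0 T, u t + ϱ * rlInt α u t = rlInt α h t) :
    ∀ t ∈ Icc 0 T, 0 ≤ u t := by
  intro t ht
  have hone : LocBdd fun _ => (1 : ℝ) := continuous_const.locBdd
  -- add a small multiple of the solution with source `1` to make the source positive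
  obtain ⟨v, hv, hveq⟩ := exists_linear_volterra hα hα1.le (ht.1.trans ht.2) ϱ
    (continuous_rlInt hα hα1.le hone)
  have key : ∀ δ : ℝ, 0 < δ → 0 ≤ u t + δ * v t := by
    intro δ hδ
    refine relaxation_nonneg_of_pos (h := fun s => h s + δ * 1) (u := fun s => u s + δ * v s)
      hα hα1 hϱ hδ (hh.add (hone.const_mul δ)) (fun s hs => by linarith [hh0 s hs])
      (hu.add (continuous_const.mul hv)) (fun s hs => ?_) t ht
    have hvδ := hv.locBdd.const_mul δ
    rw [rlInt_sub hα (hh.add (hone.const_mul δ)) ((hu.locBdd.add hvδ).const_mul ϱ),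
      rlInt_add hα hh (hone.const_mul δ), rlInt_const_mul, rlInt_const_mul,
      rlInt_add hα hu.locBdd hvδ, rlInt_const_mul]
    linear_combination heq s hs + δ * hveq s hs
  have hlim : Tendsto (fun δ : ℝ => u t + δ * v t) (𝓝[>] 0) (𝓝 (u t)) := by
    have : Continuous fun δ : ℝ => u t + δ * v t := by fun_prop
    simpa using (this.tendsto 0).mono_left nhdsWithin_le_nhds
  exact ge_of_tendsto hlim (by filter_upwards [self_mem_nhdsWithin] with δ hδ using key δ hδ)

variable {κ : ℝ}

/-- The solution of `e + ϱ J^α e = J^(κ + α) h` is `J^κ` of the solution of the relaxation equation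
with source `h`. -/
lemma two_term_nonneg (hα : 0 < α) (hα1 : α < 1) (hκ : 0 < κ) (hκ1 : κ ≤ 1) (hϱ : 0 < ϱ)
    {h e : ℝ → ℝ} (hh : LocBdd h) (hh0 : ∀ t ∈ Ioc 0 T, 0 ≤ h t) (he : Continuous e)
    (heq : ∀ t ∈ Icc 0 T, e t + ϱ * rlInt α e t = rlInt (κ + α) h t) :
    ∀ t ∈ Icc 0 T, 0 ≤ e t := by
  intro t ht
  obtain ⟨u, hu, hueq⟩ := exists_linear_volterra hα hα1.le (ht.1.trans ht.2) ϱ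
    (continuous_rlInt hα hα1.le hh)
  have hu0 := relaxation_nonneg hα hα1 hϱ hh hh0 hu hueq
  have hκu : Continuous (rlInt κ u) := continuous_rlInt hκ hκ1 hu.locBdd
  have hd := eq_zero_of_linear_volterra (T := T) (ϱ := ϱ) hα (he.sub hκu) (fun s hs => by
    have h1 : rlInt κ (fun r => u r + ϱ * rlInt α u r) s = rlInt κ (rlInt α h) s :=
      rlInt_congr fun r hr => hueq r ⟨hr.1.le, hr.2.le.trans hs.2⟩
    rw [rlInt_add hκ hu.locBdd ((locBdd_rlInt hα hα1.le hu.locBdd).const_mul ϱ), rlInt_const_mul,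
      rlInt_rlInt hκ hα hu.locBdd, rlInt_rlInt hκ hα hh] at h1
    have h2 : rlInt α (e - rlInt κ u) s = rlInt α e s - rlInt α (rlInt κ u) s :=
      rlInt_sub hα he.locBdd hκu.locBdd
    rw [h2, rlInt_rlInt hα hκ hu.locBdd, add_comm α κ, Pi.sub_apply]
    linear_combination heq s hs - h1) t ht
  rw [Pi.sub_apply, sub_eq_zero] at hd
  rw [hd]
  exact rlInt_nonneg hκ fun s hs => hu0 s ⟨hs.1.le, hs.2.trans ht.2⟩

/-- Comparison principle: the lower order term with `ϱ > 0` only damps, so the solution of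
`e + ϱ J^α e = J^(κ + α) h` is bounded by what it would be without that term. -/
lemma abs_le_rlInt_of_two_term (hα : 0 < α) (hα1 : α < 1) (hκ : 0 < κ) (hκα : κ + α ≤ 1)
    (hϱ : 0 < ϱ) {h H e : ℝ → ℝ} (hh : LocBdd h) (hH : LocBdd H)
    (hhH : ∀ t ∈ Ioc 0 T, |h t| ≤ H t) (he : Continuous e)
    (heq : ∀ t ∈ Icc 0 T, e t + ϱ * rlInt α e t = rlInt (κ + α) h t) :
    ∀ t ∈ Icc 0 T, |e t| ≤ rlInt (κ + α) H t := by
  intro t ht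
  have hκ1 : κ ≤ 1 := by linarith
  have hμ : 0 < κ + α := by linarith
  obtain ⟨E, hE, hEeq⟩ := exists_linear_volterra hα hα1.le (ht.1.trans ht.2) ϱ
    (continuous_rlInt hμ hκα hH)
  have h0 := two_term_nonneg hα hα1 hκ hκ1 hϱ hH
    (fun s hs => (abs_nonneg _).trans (hhH s hs)) hE hEeq
  have h1 := two_term_nonneg hα hα1 hκ hκ1 hϱ (hH.sub hh)
    (fun s hs => sub_nonneg.2 ((le_abs_self _).trans (hhH s hs))) (hE.sub he) (fun s hs => by
      have : rlInt α (E - e) s = rlInt α E s - rlInt α e s := rlInt_sub hα hE.locBdd he.locBdd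
      rw [this, rlInt_sub hμ hH hh, Pi.sub_apply]
      linear_combination hEeq s hs - heq s hs) t ht
  have h2 := two_term_nonneg hα hα1 hκ hκ1 hϱ (hH.add hh)
    (fun s hs => by linarith [neg_abs_le (h s), hhH s hs]) (hE.add he) (fun s hs => by
      have : rlInt α (E + e) s = rlInt α E s + rlInt α e s := rlInt_add hα hE.locBdd he.locBdd
      rw [this, rlInt_add hμ hH hh, Pi.add_apply]
      linear_combination hEeq s hs + heq s hs) t ht
  rw [Pi.sub_apply] at h1
  rw [Pi.add_apply] at h2
  have h3 : 0 ≤ ϱ * rlInt α E t :=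
    mul_nonneg hϱ.le (rlInt_nonneg hα fun s hs => h0 s ⟨hs.1.le, hs.2.trans ht.2⟩)
  rw [← hEeq t ht, abs_le]
  constructor <;> linarith

end Relaxation

/-! ### The Mittag-Leffler function and a Gronwall inequality -/

section MittagLeffler

variable {a t : ℝ}

/-- The left side is `J^a 1`, so the weighted estimate for `J^a` bounds the terms of the
Mittag-Leffler series by those of a geometric series. -/
lemma rpow_div_Gamma_le (ha : 0 ≤ a) {c : ℝ} (hc : 0 < c) (ht : 0 ≤ t) :
    t ^ a / Real.Gamma (a + 1) ≤ (1 / c) ^ a * Real.exp (c * t) := by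
  rcases ha.eq_or_lt with rfl | ha
  · simpa using mul_nonneg hc.le ht
  have h := rlInt_const ha 1 ht
  rw [one_mul] at h
  rw [← h]
  refine (rlInt_mono ha continuous_const.locBdd
    (by fun_prop : Continuous fun s => Real.exp (c * s)).locBdd fun s hs => ?_).trans
    (rlInt_exp_le ha hc t)
  exact Real.one_le_exp (mul_nonneg hc.le hs.1.le)

lemma summable_mittagLeffler (ha : 0 < a) {x : ℝ} (hx : 0 ≤ x) :
    Summable fun k : ℕ => x ^ k / Real.Gamma (a * k + 1) := by
  obtain ⟨c, hc0, hc⟩ := exists_weight ha 1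
  rw [abs_one, one_mul] at hc
  set t := x ^ a⁻¹ with ht
  have ht0 : 0 ≤ t := Real.rpow_nonneg hx _
  have hxt : ∀ k : ℕ, x ^ k = t ^ (a * k) := fun k => by
    rw [ht, ← Real.rpow_mul hx, inv_mul_cancel_left₀ ha.ne', Real.rpow_natCast]
  refine Summable.of_nonneg_of_le
    (fun k => div_nonneg (by positivity) (Real.Gamma_pos_of_pos (by positivity)).le) (fun k => ?_)
    ((summable_geometric_of_lt_one (r := (1 / 2 : ℝ)) (by norm_num) (by norm_num)).mul_right
      (Real.exp (c * t)))
  rw [hxt]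
  refine (rpow_div_Gamma_le (by positivity) hc0 ht0).trans ?_
  rw [Real.rpow_mul (by positivity), Real.rpow_natCast]
  gcongr

lemma mittagLeffler_mono (ha : 0 < a) {x y : ℝ} (hx : 0 ≤ x) (hxy : x ≤ y) :
    mittagLeffler a x ≤ mittagLeffler a y :=
  (summable_mittagLeffler ha hx).tsum_le_tsum (fun k =>
    div_le_div_of_nonneg_right (pow_le_pow_left₀ hx hxy k)
      (Real.Gamma_pos_of_pos (by positivity)).le) (summable_mittagLeffler ha (hx.trans hxy))

lemma one_le_mittagLeffler (ha : 0 < a) {x : ℝ} (hx : 0 ≤ x) : 1 ≤ mittagLeffler a x := by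
  have h := (summable_mittagLeffler ha hx).le_tsum 0 fun k _ =>
    div_nonneg (pow_nonneg hx k) (Real.Gamma_pos_of_pos (by positivity)).le
  simpa [mittagLeffler] using h

/-- The function `t ↦ M_a(t ^ a)`, extended by the constant `1` to negative times. -/
noncomputable def mlPow (a t : ℝ) : ℝ := mittagLeffler a (max t 0 ^ a)

lemma mlPow_of_nonneg (ht : 0 ≤ t) : mlPow a t = mittagLeffler a (t ^ a) := by
  rw [mlPow, max_eq_left ht]

lemma one_le_mlPow (ha : 0 < a) (t : ℝ) : 1 ≤ mlPow a t :=
  one_le_mittagLeffler ha (Real.rpow_nonneg (le_max_right _ _) _)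

lemma monotone_mlPow (ha : 0 < a) : Monotone (mlPow a) := fun _ _ h =>
  mittagLeffler_mono ha (Real.rpow_nonneg (le_max_right _ _) _)
    (Real.rpow_le_rpow (le_max_right _ _) (max_le_max_right 0 h) ha.le)

lemma locBdd_mlPow (ha : 0 < a) : LocBdd (mlPow a) where
  measurable := (monotone_mlPow ha).measurable
  bound T := by
    have h0 : ∀ t, 0 ≤ mlPow a t := fun t => zero_le_one.trans (one_le_mlPow ha t)
    exact ⟨mlPow a T, h0 T, fun t ht => by
      rw [abs_of_nonneg (h0 t)]; exact monotone_mlPow ha ht.2⟩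

lemma rlInt_rpow_div_Gamma (ha : 0 < a) (k : ℕ) (ht : 0 ≤ t) :
    rlInt a (fun s => s ^ (a * k) / Real.Gamma (a * k + 1)) t
      = t ^ (a * (k + 1 : ℕ)) / Real.Gamma (a * (k + 1 : ℕ) + 1) := by
  have e : (fun s : ℝ => s ^ (a * k) / Real.Gamma (a * k + 1))
      = fun s => (1 / Real.Gamma (a * k + 1)) * s ^ (a * k) := by
    ext s; ring
  have hΓ : Real.Gamma (a * k + 1) ≠ 0 := (Real.Gamma_pos_of_pos (by positivity)).ne'
  rw [e, rlInt_const_mul, rlInt_rpow ha (by positivity) ht,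
    show a * ((k + 1 : ℕ) : ℝ) = a + a * k by push_cast; ring]
  field_simp

lemma locBdd_rpow (ha : 0 ≤ a) : LocBdd fun s : ℝ => s ^ a :=
  (Real.continuous_rpow_const ha).locBdd

/-- Termwise integration gives `J^a M_a(t^a) = M_a(t^a) - 1`. -/
lemma rlInt_mlPow_le (ha : 0 < a) (ht : 0 ≤ t) : rlInt a (mlPow a) t ≤ mlPow a t := by
  set E : ℕ → ℝ → ℝ := fun k s => s ^ (a * k) / Real.Gamma (a * k + 1) with hE
  have hEl : ∀ k, LocBdd (E k) := fun k => by
    have := (locBdd_rpow (a := a * k) (by positivity)).const_mul (1 / Real.Gamma (a * k + 1))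
    simpa [hE, div_eq_inv_mul] using this
  have hterm : ∀ s, 0 ≤ s → ∀ k : ℕ, (s ^ a) ^ k / Real.Gamma (a * k + 1) = E k s := by
    intro s hs k
    rw [← Real.rpow_natCast, ← Real.rpow_mul hs]
  have hsum := summable_mittagLeffler ha (Real.rpow_nonneg ht a)
  simp only [hterm t ht] at hsum
  have hint : ∀ k, IntegrableOn (fun s => (t - s) ^ (a - 1) / Real.Gamma a * E k s) (Ioc 0 t) :=
    fun k => rlInt_integrableOn' ha (hEl k) t
  have hval : ∀ k, ∫ s in Ioc 0 t, (t - s) ^ (a - 1) / Real.Gamma a * E k s = E (k + 1) t :=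
    fun k => rlInt_rpow_div_Gamma ha k ht
  have hnorm : ∀ k, ∫ s in Ioc 0 t, ‖(t - s) ^ (a - 1) / Real.Gamma a * E k s‖ = E (k + 1) t := by
    intro k
    rw [← hval k]
    refine setIntegral_congr_fun measurableSet_Ioc fun s hs => ?_
    exact Real.norm_of_nonneg (mul_nonneg (kernel_nonneg ha (sub_nonneg.2 hs.2))
      (div_nonneg (Real.rpow_nonneg hs.1.le _) (Real.Gamma_pos_of_pos (by positivity)).le))
  have hs1 : Summable fun k => E (k + 1) t := (summable_nat_add_iff 1).2 hsum
  have h := hasSum_integral_of_summable_integral_norm hint (by simpa only [hnorm] using hs1)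
  simp only [hval] at h
  have e1 : ∫ s in Ioc 0 t, ∑' k, (t - s) ^ (a - 1) / Real.Gamma a * E k s
      = rlInt a (mlPow a) t := by
    refine setIntegral_congr_fun measurableSet_Ioc fun s hs => ?_
    simp only [tsum_mul_left]
    rw [mlPow_of_nonneg hs.1.le, mittagLeffler, tsum_congr (hterm s hs.1.le)]
  rw [e1] at h
  rw [mlPow_of_nonneg ht, mittagLeffler, tsum_congr (hterm t ht), hsum.tsum_eq_zero_add, h.tsum_eq]
  have : E 0 t = 1 := by simp [hE]
  linarith

/-- A Gronwall inequality for Riemann-Liouville integrals. The hypothesis asks that every monotone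
bound of `φ` can be improved by one application of `b + A J^a`; this form admits delays. -/
lemma le_mittagLeffler_of_improving_bound (ha : 0 < a) {A b : ℝ} (hA : 0 ≤ A) (hb : 0 ≤ b)
    (ht : 0 ≤ t) {φ : ℝ → ℝ} (hφ : Continuous φ)
    (h : ∀ B, LocBdd B → MonotoneOn B (Icc 0 t) → (∀ s ∈ Icc 0 t, φ s ≤ B s) →
      ∀ s ∈ Icc 0 t, φ s ≤ b + A * rlInt a B s) :
    φ t ≤ b * mittagLeffler a (A * t ^ a) := by
  obtain ⟨K, hK0, hK⟩ := hφ.locBdd.bound t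
  set E : ℕ → ℝ → ℝ := fun k s => A ^ k * (s ^ (a * k) / Real.Gamma (a * k + 1)) with hE
  have hEl : ∀ k, LocBdd (E k) := fun k => by
    have := ((locBdd_rpow (a := a * k) (by positivity)).const_mul
      (1 / Real.Gamma (a * k + 1))).const_mul (A ^ k)
    simpa [hE, div_eq_inv_mul] using this
  have hEm : ∀ k, MonotoneOn (E k) (Icc 0 t) := fun k r hr s _ hrs =>
    mul_le_mul_of_nonneg_left (div_le_div_of_nonneg_right
      (Real.rpow_le_rpow hr.1 hrs (by positivity)) (Real.Gamma_pos_of_pos (by positivity)).le)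
      (pow_nonneg hA k)
  have hstep : ∀ k, ∀ s, 0 ≤ s → A * rlInt a (E k) s = E (k + 1) s := by
    intro k s hs
    rw [rlInt_const_mul, rlInt_rpow_div_Gamma ha k hs, ← mul_assoc, ← pow_succ']
  set S : ℕ → ℝ → ℝ := fun N s => ∑ k ∈ Finset.range N, E k s with hS
  have hSl : ∀ N, LocBdd (S N) ∧ MonotoneOn (S N) (Icc 0 t) ∧
      ∀ s, 0 ≤ s → 1 + A * rlInt a (S N) s = S (N + 1) s := by
    intro N
    induction N with
    | zero =>
      refine ⟨by simpa [hS] using (continuous_const (y := (0 : ℝ))).locBdd, fun _ _ _ _ _ => by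
        simp [hS], fun s _ => ?_⟩
      simp [hS, hE, rlInt]
    | succ N ih =>
      have e : S (N + 1) = fun s => S N s + E N s := by
        ext s; simp [hS, Finset.sum_range_succ]
      refine ⟨?_, ?_, fun s hs => ?_⟩
      · rw [e]; exact ih.1.add (hEl N)
      · rw [e]; exact ih.2.1.add (hEm N)
      · have e2 : S (N + 1 + 1) s = S (N + 1) s + E (N + 1) s := by
          simp only [hS]; rw [Finset.sum_range_succ]
        rw [e2, ← ih.2.2 s hs, ← hstep N s hs, e, rlInt_add ha ih.1 (hEl N)]
        ring
  have hbound : ∀ N, ∀ s ∈ Icc 0 t, φ s ≤ b * S N s + K * E N s := by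
    intro N
    induction N with
    | zero =>
      intro s hs
      simpa [hS, hE] using (le_abs_self _).trans (hK s hs)
    | succ N ih =>
      intro s hs
      obtain ⟨h1, h2, h3⟩ := hSl N
      have h4 := h (fun s => b * S N s + K * E N s) ((h1.const_mul b).add ((hEl N).const_mul K))
        (fun x hx y hy hxy => add_le_add (mul_le_mul_of_nonneg_left (h2 hx hy hxy) hb)
          (mul_le_mul_of_nonneg_left (hEm N hx hy hxy) hK0)) ih s hs
      rw [rlInt_add ha (h1.const_mul b) ((hEl N).const_mul K), rlInt_const_mul,
        rlInt_const_mul] at h4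
      rw [← h3 s hs.1, ← hstep N s hs.1]
      linarith
  have hsum := summable_mittagLeffler ha (mul_nonneg hA (Real.rpow_nonneg ht a))
  have hterm : ∀ k : ℕ, (A * t ^ a) ^ k / Real.Gamma (a * k + 1) = E k t := by
    intro k
    rw [mul_pow, ← Real.rpow_natCast (t ^ a), ← Real.rpow_mul ht, mul_div_assoc]
  simp only [hterm] at hsum
  have hlim : Tendsto (fun N => b * S N t + K * E N t) atTop
      (𝓝 (b * mittagLeffler a (A * t ^ a) + K * 0)) := by
    refine (Tendsto.const_mul b ?_).add (hsum.tendsto_atTop_zero.const_mul K)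
    rw [mittagLeffler, tsum_congr hterm]
    exact hsum.hasSum.tendsto_sum_nat
  have := ge_of_tendsto' hlim fun N => hbound N t ⟨ht, le_rfl⟩
  simpa using this

end MittagLeffler

/-! ### The fractional differential equation in integrated form -/

/-- The Riemann-Liouville integral of order `a ≥ 0` based at `0`, the identity for `a = 0`. -/
noncomputable def rlInt₀ (a : ℝ) (p : ℝ → ℝ) (t : ℝ) : ℝ :=
  if a = 0 then p t else rlInt a p t

section Integrated

variable {μ κ ϱ T t : ℝ}

lemma continuous_rlInt₀ {a : ℝ} (ha : 0 ≤ a) (ha1 : a ≤ 1) {u : ℝ → ℝ} (hu : Continuous u) :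
    Continuous (rlInt₀ a u) := by
  unfold rlInt₀
  split_ifs with h
  · exact hu
  · exact continuous_rlInt (lt_of_le_of_ne ha (Ne.symm h)) ha1 hu.locBdd

lemma rlInt_rlInt₀ {a b : ℝ} (ha : 0 < a) (hb : 0 ≤ b) {u : ℝ → ℝ} (hu : LocBdd u) :
    rlInt a (rlInt₀ b u) t = rlInt (a + b) u t := by
  rcases hb.eq_or_lt with rfl | hb
  · rw [add_zero]; exact rlInt_congr fun s _ => by simp [rlInt₀]
  · rw [← rlInt_rlInt ha hb hu]; exact rlInt_congr fun s _ => by simp [rlInt₀, hb.ne']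

lemma rlInt₀_rlInt {a b : ℝ} (ha : 0 ≤ a) (hb : 0 < b) {u : ℝ → ℝ} (hu : LocBdd u) :
    rlInt₀ a (rlInt b u) t = rlInt (a + b) u t := by
  unfold rlInt₀
  split_ifs with h
  · rw [h, zero_add]
  · exact rlInt_rlInt (lt_of_le_of_ne ha (Ne.symm h)) hb hu

lemma rlInt_one_hasDerivWithinAt {d : ℝ → ℝ} (hd : Continuous d) (ht : t ∈ Icc 0 T) :
    HasDerivWithinAt (rlInt 1 d) (d t) (Icc 0 T) t := by
  refine (hd.integral_hasStrictDerivAt 0 t).hasDerivAt.hasDerivWithinAt.congr_of_mem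
    (fun s hs => ?_) ht
  rw [rlInt_one_eq, intervalIntegral.integral_of_le hs.1]

lemma eq_zero_of_rlInt_one_eq_zero (hT : 0 < T) {d : ℝ → ℝ} (hd : Continuous d)
    (h : ∀ t ∈ Icc 0 T, rlInt 1 d t = 0) : ∀ t ∈ Icc 0 T, d t = 0 := by
  intro t ht
  have h1 := rlInt_one_hasDerivWithinAt hd ht
  have h2 : HasDerivWithinAt (rlInt 1 d) 0 (Icc 0 T) t :=
    (hasDerivWithinAt_const t (Icc 0 T) (0 : ℝ)).congr_of_mem h ht
  exact (uniqueDiffOn_Icc hT t ht).eq_deriv _ h1 h2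

/-- If `J^(1-μ) u + ϱ J^(1-κ) u` has the derivative `h`, then `u + ϱ J^(μ-κ) u = J^μ h`. -/
lemma two_term_of_hasDerivAt (hκ : 0 < κ) (hκμ : κ < μ) (hμ : μ ≤ 1) (hT : 0 < T) {u h : ℝ → ℝ}
    (hu : Continuous u) (hu0 : u 0 = 0) (hh : LocBdd h)
    (hder : ∀ t ∈ Ioo 0 T,
      HasDerivAt (fun s => rlInt₀ (1 - μ) u s + ϱ * rlInt₀ (1 - κ) u s) (h t) t) :
    ∀ t ∈ Icc 0 T, u t + ϱ * rlInt (μ - κ) u t = rlInt μ h t := by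
  have hα : 0 < μ - κ := sub_pos.2 hκμ
  have hμ0 : 0 < μ := hκ.trans hκμ
  have hc1 := continuous_rlInt₀ (a := 1 - μ) (by linarith) (by linarith) hu
  have hc2 := continuous_rlInt₀ (a := 1 - κ) (by linarith) (by linarith) hu
  have hcα := continuous_rlInt hα (by linarith) hu.locBdd
  set F : ℝ → ℝ := fun s => rlInt₀ (1 - μ) u s + ϱ * rlInt₀ (1 - κ) u s with hF
  have hFc : Continuous F := hc1.add (continuous_const.mul hc2)
  have hz : ∀ a, rlInt₀ a u 0 = 0 := fun a => by
    unfold rlInt₀; split_ifs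
    · exact hu0
    · exact rlInt_of_nonpos le_rfl
  have hF1 : ∀ t ∈ Icc 0 T, F t = rlInt 1 h t := by
    intro t ht
    have hi : IntegrableOn h (Ioc 0 t) := by simpa using rlInt_integrableOn' one_pos hh t
    have := intervalIntegral.integral_eq_sub_of_hasDerivAt_of_le ht.1 hFc.continuousOn
      (fun s hs => hder s ⟨hs.1, hs.2.trans_le ht.2⟩)
      ((intervalIntegrable_iff_integrableOn_Ioc_of_le ht.1).2 hi)
    rw [rlInt_one_eq, ← intervalIntegral.integral_of_le ht.1, this]
    simp [hF, hz]
  have hdc : Continuous fun t => u t + ϱ * rlInt (μ - κ) u t - rlInt μ h t :=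
    (hu.add (continuous_const.mul hcα)).sub (continuous_rlInt hμ0 hμ hh)
  intro t ht
  refine sub_eq_zero.1 (eq_zero_of_rlInt_one_eq_zero hT hdc (fun s hs => ?_) t ht)
  rw [rlInt_sub one_pos (hu.locBdd.add (hcα.locBdd.const_mul ϱ)) (locBdd_rlInt hμ0 hμ hh),
    rlInt_add one_pos hu.locBdd (hcα.locBdd.const_mul ϱ), rlInt_const_mul,
    rlInt_rlInt one_pos hα hu.locBdd, rlInt_rlInt one_pos hμ0 hh]
  have h1 : rlInt μ F s = rlInt μ (rlInt 1 h) s :=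
    rlInt_congr fun r hr => hF1 r ⟨hr.1.le, hr.2.le.trans hs.2⟩
  rw [rlInt_rlInt hμ0 one_pos hh, rlInt_add hμ0 hc1.locBdd (hc2.locBdd.const_mul ϱ),
    rlInt_const_mul, rlInt_rlInt₀ hμ0 (by linarith) hu.locBdd,
    rlInt_rlInt₀ hμ0 (by linarith) hu.locBdd, add_sub_cancel, add_comm μ 1,
    show μ + (1 - κ) = 1 + (μ - κ) by ring] at h1
  rw [h1, sub_self]

/-- For `ν ≤ μ` the Caputo derivative of order `ν` of `J^μ w` is `J^(μ-ν) w`. -/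
lemma hasDerivWithinAt_rlInt₀_rlInt {ν : ℝ} (hν : 0 < ν) (hνμ : ν ≤ μ) (hμ : μ ≤ 1) {w : ℝ → ℝ}
    (hw : Continuous w) (ht : t ∈ Icc 0 T) :
    HasDerivWithinAt (rlInt₀ (1 - ν) (rlInt μ w)) (rlInt₀ (μ - ν) w t) (Icc 0 T) t := by
  have e : rlInt₀ (1 - ν) (rlInt μ w) = rlInt 1 (rlInt₀ (μ - ν) w) := by
    ext s
    rw [rlInt₀_rlInt (by linarith) (hν.trans_le hνμ) hw.locBdd,
      rlInt_rlInt₀ one_pos (by linarith) hw.locBdd]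
    congr 1
    ring
  rw [e]
  exact rlInt_one_hasDerivWithinAt (continuous_rlInt₀ (by linarith) (by linarith) hw) ht

end Integrated

/-! ### The change of time `t = Φ(l) - Φ(m)` -/

section ChangeOfTime

variable {m n : ℝ} {Φ : ℝ → ℝ}

/-- The inverse time change, extended to a continuous function on the line. -/
lemma exists_inverse_time (hmn : m ≤ n) (hΦ : StrictMonoOn Φ (Icc m n))
    (hΦc : ContinuousOn Φ (Icc m n)) :
    ∃ ψ : ℝ → ℝ, Continuous ψ ∧ (∀ t, ψ t ∈ Icc m n) ∧ (∀ l ∈ Icc m n, ψ (Φ l - Φ m) = l) ∧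
      ∀ t ∈ Icc 0 (Φ n - Φ m), Φ (ψ t) - Φ m = t := by
  have hT : 0 ≤ Φ n - Φ m := sub_nonneg.2 (hΦ.monotoneOn ⟨le_rfl, hmn⟩ ⟨hmn, le_rfl⟩ hmn)
  have hmaps : ∀ l ∈ Icc m n, Φ l - Φ m ∈ Icc 0 (Φ n - Φ m) := fun l hl =>
    ⟨sub_nonneg.2 (hΦ.monotoneOn ⟨le_rfl, hmn⟩ hl hl.1),
      sub_le_sub_right (hΦ.monotoneOn hl ⟨hmn, le_rfl⟩ hl.2) _⟩
  let g : Icc m n → Icc 0 (Φ n - Φ m) := fun l => ⟨Φ l - Φ m, hmaps l l.2⟩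
  have hg : Continuous g :=
    Continuous.subtype_mk ((continuousOn_iff_continuous_domRestrict.1 hΦc).sub continuous_const) _
  have hinj : Function.Injective g := fun x y h => by
    have h1 := congrArg Subtype.val h
    exact Subtype.ext (hΦ.injOn x.2 y.2 (sub_left_injective h1))
  have hsurj : Function.Surjective g := by
    rintro ⟨t, ht⟩
    obtain ⟨l, hl, h⟩ := intermediate_value_Icc hmn (hΦc.sub continuousOn_const)
      (show t ∈ Icc (Φ m - Φ m) (Φ n - Φ m) by simpa using ht)
    exact ⟨⟨l, hl⟩, Subtype.ext h⟩
  let e := (show Continuous (Equiv.ofBijective g ⟨hinj, hsurj⟩) from hg).homeoOfEquivCompactToT2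
  refine ⟨fun t => e.symm (projIcc 0 _ hT t),
    continuous_subtype_val.comp (e.symm.continuous.comp continuous_projIcc),
    fun t => (e.symm _).2, fun l hl => ?_, fun t ht => ?_⟩
  · have : e ⟨l, hl⟩ = ⟨Φ l - Φ m, hmaps l hl⟩ := rfl
    beta_reduce
    rw [projIcc_of_mem hT (hmaps l hl), ← this, e.symm_apply_apply]
  · have := congrArg Subtype.val (e.apply_symm_apply ⟨t, ht⟩)
    beta_reduce
    rw [projIcc_of_mem hT ht]
    exact this

/-- In the time `t = Φ(l) - Φ(m)` the primitive of the `Φ`-Caputo derivative is an ordinary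
Riemann-Liouville integral. -/
lemma caputoPrimitive_eq_rlInt₀ (hΦ : StrictMonoOn Φ (Icc m n))
    (hΦd : DifferentiableOn ℝ Φ (Icc m n)) (ν : ℝ) {z u : ℝ → ℝ}
    (hzu : ∀ s ∈ Icc m n, z s - z m = u (Φ s - Φ m)) {l : ℝ} (hl : l ∈ Icc m n) :
    caputoPrimitive m n Φ ν z l = rlInt₀ (1 - ν) u (Φ l - Φ m) := by
  unfold caputoPrimitive fracIntegral rlInt₀
  split_ifs with h
  · exact hzu l hl
  have hsub : Icc m l ⊆ Icc m n := Icc_subset_Icc_right hl.2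
  have hsub' : Ioc m l ⊆ Icc m n := Ioc_subset_Icc_self.trans hsub
  have himage : (fun s => Φ s - Φ m) '' Ioc m l = Ioc 0 (Φ l - Φ m) := by
    ext t
    constructor
    · rintro ⟨s, hs, rfl⟩
      exact ⟨sub_pos.2 (hΦ (hsub ⟨le_rfl, hl.1⟩) (hsub' hs) hs.1),
        sub_le_sub_right (hΦ.monotoneOn (hsub' hs) hl hs.2) _⟩
    · rintro ⟨ht0, htl⟩
      obtain ⟨s, hs, rfl⟩ := intermediate_value_Ioc hl.1
        ((hΦd.continuousOn.mono hsub).sub (continuousOn_const (c := Φ m)))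
        (show t ∈ Ioc (Φ m - Φ m) (Φ l - Φ m) by simpa using ⟨ht0, htl⟩)
      exact ⟨s, hs, rfl⟩
  have hcv := integral_image_eq_integral_abs_deriv_smul measurableSet_Ioc
    (f := fun s => Φ s - Φ m) (f' := dPhi m n Φ) (s := Ioc m l)
    (fun s hs => (((hΦd s (hsub' hs)).hasDerivWithinAt.sub_const _).mono hsub'))
    (fun s hs s' hs' h => hΦ.injOn (hsub' hs) (hsub' hs') (sub_left_injective h))
    (fun t => (Φ l - Φ m - t) ^ (1 - ν - 1) / Real.Gamma (1 - ν) * u t)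
  rw [himage] at hcv
  rw [rlInt, hcv, intervalIntegral.integral_of_le hl.1]
  refine setIntegral_congr_fun measurableSet_Ioc fun s hs => ?_
  have h0 : 0 ≤ dPhi m n Φ s := hΦ.monotoneOn.derivWithin_nonneg
  simp only [smul_eq_mul]
  rw [abs_of_nonneg h0, hzu s (hsub' hs), sub_sub_sub_cancel_right]
  ring

lemma hasDerivAt_rlInt₀_of_caputoDifferentiableAt (hΦ : StrictMonoOn Φ (Icc m n))
    (hΦd : DifferentiableOn ℝ Φ (Icc m n))
    (hΦne : ∀ l ∈ Icc m n, derivWithin Φ (Icc m n) l ≠ 0) {ψ : ℝ → ℝ} (hψ : Continuous ψ)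
    (hψm : ∀ t, ψ t ∈ Icc m n) (hψΦ : ∀ l ∈ Icc m n, ψ (Φ l - Φ m) = l)
    (hΦψ : ∀ t ∈ Icc 0 (Φ n - Φ m), Φ (ψ t) - Φ m = t) {ν : ℝ} {z : ℝ → ℝ} {t : ℝ}
    (ht : t ∈ Ioo 0 (Φ n - Φ m)) (hz : CaputoDifferentiableAt m n Φ ν z (ψ t)) :
    HasDerivAt (rlInt₀ (1 - ν) fun s => z (ψ s) - z m) (caputoDeriv m n Φ ν z (ψ t)) t := by
  have hmn : m ≤ n := (hψm t).1.trans (hψm t).2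
  have hΦψt := hΦψ t (Ioo_subset_Icc_self ht)
  have hψt : ψ t ∈ Ioo m n := by
    refine ⟨lt_of_le_of_ne (hψm t).1 fun h => ?_, lt_of_le_of_ne (hψm t).2 fun h => ?_⟩
    · rw [← h, sub_self] at hΦψt; exact ht.1.ne hΦψt
    · rw [h] at hΦψt; exact ht.2.ne hΦψt.symm
  have hnhds : Icc m n ∈ 𝓝 (ψ t) := Icc_mem_nhds hψt.1 hψt.2
  have hev : ∀ᶠ s in 𝓝 t, Φ (ψ s) - Φ m = s := by
    filter_upwards [Icc_mem_nhds ht.1 ht.2] with s hs using hΦψ s hs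
  have h1 : HasDerivAt (fun l => Φ l - Φ m) (dPhi m n Φ (ψ t)) (ψ t) :=
    ((hΦd _ (hψm t)).hasDerivWithinAt.hasDerivAt hnhds).sub_const _
  have h2 : HasDerivAt ψ (dPhi m n Φ (ψ t))⁻¹ t :=
    h1.of_local_left_inverse hψ.continuousAt (hΦne _ (hψm t)) hev
  have h3 := (hz.hasDerivWithinAt.hasDerivAt hnhds).comp t h2
  rw [← div_eq_mul_inv] at h3
  refine h3.congr_of_eventuallyEq ?_
  filter_upwards [hev] with s hs
  rw [Function.comp_apply, caputoPrimitive_eq_rlInt₀ hΦ hΦd ν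
    (u := fun s => z (ψ s) - z m) (fun l hl => by rw [hψΦ l hl]) (hψm s), hs]

/-- An admissible function whose combination of fractional derivatives is bounded solves the
two-term integral equation, with that combination, in the new time, as source. -/
lemma exists_source {μ κ ϱ C : ℝ} (hmn : m < n) (hκ : 0 < κ) (hκμ : κ < μ) (hμ : μ ≤ 1)
    (hΦ : StrictMonoOn Φ (Icc m n)) (hΦd : DifferentiableOn ℝ Φ (Icc m n))
    (hΦne : ∀ l ∈ Icc m n, derivWithin Φ (Icc m n) l ≠ 0) {ψ : ℝ → ℝ} (hψ : Continuous ψ)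
    (hψm : ∀ t, ψ t ∈ Icc m n) (hψΦ : ∀ l ∈ Icc m n, ψ (Φ l - Φ m) = l)
    (hΦψ : ∀ t ∈ Icc 0 (Φ n - Φ m), Φ (ψ t) - Φ m = t) {z : ℝ → ℝ}
    (hzc : ContinuousOn z (Icc m n))
    (hz : ∀ l ∈ Icc m n, CaputoDifferentiableAt m n Φ μ z l ∧ CaputoDifferentiableAt m n Φ κ z l)
    (hC : ∀ l ∈ Icc m n, |caputoDeriv m n Φ μ z l + ϱ * caputoDeriv m n Φ κ z l| ≤ C) :
    ∃ h : ℝ → ℝ, LocBdd h ∧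
      (∀ t ∈ Ioo 0 (Φ n - Φ m),
        h t = caputoDeriv m n Φ μ z (ψ t) + ϱ * caputoDeriv m n Φ κ z (ψ t)) ∧
      (∀ t ∉ Ioo 0 (Φ n - Φ m), h t = 0) ∧
      ∀ t ∈ Icc 0 (Φ n - Φ m), z (ψ t) - z m + ϱ * rlInt (μ - κ) (fun s => z (ψ s) - z m) t
        = rlInt μ h t := by
  have hT : 0 < Φ n - Φ m := sub_pos.2 (hΦ ⟨le_rfl, hmn.le⟩ ⟨hmn.le, le_rfl⟩ hmn)
  set u : ℝ → ℝ := fun s => z (ψ s) - z m with hu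
  have huc : Continuous u := (hzc.comp_continuous hψ hψm).sub continuous_const
  have hu0 : u 0 = 0 := by
    have := hψΦ m ⟨le_rfl, hmn.le⟩
    rw [sub_self] at this
    simp [hu, this]
  set F : ℝ → ℝ := fun s => rlInt₀ (1 - μ) u s + ϱ * rlInt₀ (1 - κ) u s with hF
  have hder : ∀ t ∈ Ioo 0 (Φ n - Φ m), HasDerivAt F
      (caputoDeriv m n Φ μ z (ψ t) + ϱ * caputoDeriv m n Φ κ z (ψ t)) t := fun t ht =>
    (hasDerivAt_rlInt₀_of_caputoDifferentiableAt hΦ hΦd hΦne hψ hψm hψΦ hΦψ ht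
      (hz _ (hψm t)).1).add
    ((hasDerivAt_rlInt₀_of_caputoDifferentiableAt hΦ hΦd hΦne hψ hψm hψΦ hΦψ ht
      (hz _ (hψm t)).2).const_mul ϱ)
  -- `deriv F` is measurable without any continuity of the fractional derivatives
  set h : ℝ → ℝ := (Ioo 0 (Φ n - Φ m)).indicator (deriv F) with hh
  have hin : ∀ t ∈ Ioo 0 (Φ n - Φ m),
      h t = caputoDeriv m n Φ μ z (ψ t) + ϱ * caputoDeriv m n Φ κ z (ψ t) := fun t ht => by
    rw [hh, indicator_of_mem ht, (hder t ht).deriv]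
  have hout : ∀ t ∉ Ioo 0 (Φ n - Φ m), h t = 0 := fun t ht => indicator_of_notMem ht _
  have hhl : LocBdd h := by
    refine ⟨(measurable_deriv F).indicator measurableSet_Ioo, fun _ => ⟨|C|, abs_nonneg _,
      fun t _ => ?_⟩⟩
    by_cases ht : t ∈ Ioo 0 (Φ n - Φ m)
    · rw [hin t ht]; exact (hC _ (hψm t)).trans (le_abs_self C)
    · rw [hout t ht, abs_zero]; exact abs_nonneg _
  exact ⟨h, hhl, hin, hout, two_term_of_hasDerivAt hκ hκμ hμ hT huc hu0 hhl
    fun t ht => by rw [hin t ht]; exact hder t ht⟩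

end ChangeOfTime

/-! ### Existence and stability for the delay equation -/

section Delay

variable {m n σ μ κ ϱ L : ℝ} {Φ : ℝ → ℝ} {Q : ℝ → ℝ → ℝ → ℝ} {f : ℝ → ℝ}

/-- The function that continues the initial datum `α` beyond `m` with fractional derivative `w`
of order `μ`: it is `α` up to `m` and `α(m) + J^μ w (Φ(l) - Φ(m))` after `m`. The encoding by `min` and `max`
makes continuity a matter of composition. -/
noncomputable def fracExtend (m : ℝ) (Φ : ℝ → ℝ) (μ : ℝ) (α w : ℝ → ℝ) (x : ℝ) : ℝ :=
  α (min x m) + rlInt μ w (Φ (max x m) - Φ m)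

lemma fracExtend_of_le {α w : ℝ → ℝ} {x : ℝ} (hx : x ≤ m) : fracExtend m Φ μ α w x = α x := by
  rw [fracExtend, min_eq_left hx, max_eq_right hx, sub_self, rlInt_of_nonpos le_rfl, add_zero]

lemma fracExtend_of_ge {α w : ℝ → ℝ} {x : ℝ} (hx : m ≤ x) :
    fracExtend m Φ μ α w x = α m + rlInt μ w (Φ x - Φ m) := by
  rw [fracExtend, min_eq_right hx, max_eq_left hx]

lemma continuousOn_fracExtend (hmn : m ≤ n) (hσ : 0 ≤ σ) (hμ0 : 0 < μ) (hμ : μ ≤ 1)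
    (hΦc : ContinuousOn Φ (Icc m n)) {α w : ℝ → ℝ} (hα : ContinuousOn α (Icc (m - σ) n))
    (hw : Continuous w) : ContinuousOn (fracExtend m Φ μ α w) (Icc (m - σ) n) := by
  refine ContinuousOn.add ?_ ?_
  · exact hα.comp (continuous_id.min continuous_const).continuousOn fun x hx =>
      ⟨le_min hx.1 (by linarith), (min_le_right _ _).trans hmn⟩
  · refine (continuous_rlInt hμ0 hμ hw.locBdd).comp_continuousOn (ContinuousOn.sub ?_
      continuousOn_const)
    exact hΦc.comp (continuous_id.max continuous_const).continuousOn fun x hx =>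
      ⟨le_max_right _ _, max_le hx.2 hmn⟩

lemma continuous_nonlinearity (hfcont : ContinuousOn f (Icc m n))
    (hfmaps : MapsTo f (Icc m n) (Icc (m - σ) n)) (hσ : 0 ≤ σ)
    (hQcont : ContinuousOn (fun p : ℝ × ℝ × ℝ => Q p.1 p.2.1 p.2.2) (Icc m n ×ˢ univ))
    {ψ : ℝ → ℝ} (hψ : Continuous ψ) (hψm : ∀ t, ψ t ∈ Icc m n) {z : ℝ → ℝ}
    (hz : ContinuousOn z (Icc (m - σ) n)) :
    Continuous fun t => Q (ψ t) (z (ψ t)) (z (f (ψ t))) := by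
  have hz1 : Continuous fun t => z (ψ t) :=
    hz.comp_continuous hψ fun t => ⟨by linarith [(hψm t).1], (hψm t).2⟩
  have hz2 : Continuous fun t => z (f (ψ t)) :=
    hz.comp_continuous (hfcont.comp_continuous hψ hψm) fun t => hfmaps (hψm t)
  exact hQcont.comp_continuous (hψ.prodMk (hz1.prodMk hz2)) fun t => ⟨hψm t, mem_univ _⟩

lemma exists_isSolution (hmn : m < n) (hσ : 0 < σ) (hκ : 0 < κ) (hκμ : κ < μ) (hμ : μ ≤ 1)
    (hϱ : 0 < ϱ) (hΦ : StrictMonoOn Φ (Icc m n)) (hΦd : DifferentiableOn ℝ Φ (Icc m n))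
    (hΦne : ∀ l ∈ Icc m n, derivWithin Φ (Icc m n) l ≠ 0) (hfcont : ContinuousOn f (Icc m n))
    (hfmaps : MapsTo f (Icc m n) (Icc (m - σ) n)) (hfdelay : ∀ l ∈ Icc m n, f l ≤ l)
    (hQcont : ContinuousOn (fun p : ℝ × ℝ × ℝ => Q p.1 p.2.1 p.2.2) (Icc m n ×ˢ univ))
    (hL : 0 < L) (hQlip : ∀ l ∈ Icc m n, ∀ a₁ a₂ b₁ b₂ : ℝ,
      |Q l b₂ a₂ - Q l b₁ a₁| ≤ L * (|b₂ - b₁| + |a₂ - a₁|))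
    {α : ℝ → ℝ} (hα : ContinuousOn α (Icc (m - σ) n)) :
    ∃ z, IsSolution m n σ Φ μ κ ϱ Q f α z := by
  have hμ0 : 0 < μ := hκ.trans hκμ
  have hβ : 0 < μ - κ := sub_pos.2 hκμ
  have hβ1 : μ - κ ≤ 1 := by linarith
  obtain ⟨ψ, hψ, hψm, hψΦ, hΦψ⟩ := exists_inverse_time hmn.le hΦ hΦd.continuousOn
  have hmem : ∀ l ∈ Icc m n, Φ l - Φ m ∈ Icc 0 (Φ n - Φ m) := fun l hl =>
    ⟨sub_nonneg.2 (hΦ.monotoneOn ⟨le_rfl, hmn.le⟩ hl hl.1),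
      sub_le_sub_right (hΦ.monotoneOn hl ⟨hmn.le, le_rfl⟩ hl.2) _⟩
  have hT : 0 ≤ Φ n - Φ m := (hmem n ⟨hmn.le, le_rfl⟩).1
  obtain ⟨c, hc, hc0⟩ : ∃ c : ℝ, L * (2 * (1 / c) ^ μ) + ϱ * (1 / c) ^ (μ - κ) ≤ 1 / 2 ∧ 0 < c := by
    have h := (((tendsto_one_div_rpow hμ0).const_mul 2).const_mul L).add
      ((tendsto_one_div_rpow hβ).const_mul ϱ)
    simp only [mul_zero, add_zero] at h
    exact ((h.eventually (Iic_mem_nhds (show (0 : ℝ) < 1 / 2 by norm_num))).and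
      (eventually_gt_atTop 0)).exists
  set Z : (ℝ → ℝ) → ℝ → ℝ := fracExtend m Φ μ α with hZ
  -- the equation for the derivative `w` of order `μ` of the solution
  obtain ⟨w, hw, hweq⟩ := exists_fixedPoint_of_weighted_contraction (c := c) (q := 1 / 2) hT
    (by norm_num) (by norm_num)
    (fun w t => Q (ψ t) (Z w (ψ t)) (Z w (f (ψ t))) - ϱ * rlInt (μ - κ) w t)
    (fun w hw => ((continuous_nonlinearity hfcont hfmaps hσ.le hQcont hψ hψm
      (continuousOn_fracExtend hmn.le hσ.le hμ0 hμ hΦd.continuousOn hα hw)).sub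
      (continuous_const.mul (continuous_rlInt hβ hβ1 hw.locBdd))).continuousOn)
    (fun w₁ w₂ h₁ h₂ K hK hw t ht => by
      have hdiff : ∀ x, max x m ≤ ψ t →
          |Z w₁ x - Z w₂ x| ≤ (1 / c) ^ μ * K * Real.exp (c * t) := by
        intro x hx
        have hxm : max x m ∈ Icc m n := ⟨le_max_right _ _, hx.trans (hψm t).2⟩
        have hxt : Φ (max x m) - Φ m ≤ t := by
          rw [← hΦψ t ht]
          exact sub_le_sub_right (hΦ.monotoneOn hxm (hψm t) hx) _
        have h := abs_rlInt_le_of_abs_le_exp hμ0 hc0 hK (h₁.locBdd.sub h₂.locBdd) hw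
          (hmem _ hxm)
        rw [rlInt_sub hμ0 h₁.locBdd h₂.locBdd] at h
        rw [hZ, fracExtend, fracExtend, add_sub_add_left_eq_sub]
        refine h.trans ?_
        gcongr
      have hQ := hQlip (ψ t) (hψm t) (Z w₂ (f (ψ t))) (Z w₁ (f (ψ t))) (Z w₂ (ψ t)) (Z w₁ (ψ t))
      have hd1 := hdiff (ψ t) (max_le le_rfl (hψm t).1)
      have hd2 := hdiff (f (ψ t)) (max_le (hfdelay _ (hψm t)) (hψm t).1)
      have hr := abs_rlInt_le_of_abs_le_exp hβ hc0 hK (h₁.locBdd.sub h₂.locBdd) hw ht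
      rw [rlInt_sub hβ h₁.locBdd h₂.locBdd] at hr
      have hE : 0 ≤ K * Real.exp (c * t) := by positivity
      calc _ = |(Q (ψ t) (Z w₁ (ψ t)) (Z w₁ (f (ψ t))) - Q (ψ t) (Z w₂ (ψ t)) (Z w₂ (f (ψ t))))
            - ϱ * (rlInt (μ - κ) w₁ t - rlInt (μ - κ) w₂ t)| := by congr 1; ring
        _ ≤ |Q (ψ t) (Z w₁ (ψ t)) (Z w₁ (f (ψ t))) - Q (ψ t) (Z w₂ (ψ t)) (Z w₂ (f (ψ t)))|
            + |ϱ * (rlInt (μ - κ) w₁ t - rlInt (μ - κ) w₂ t)| := abs_sub _ _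
        _ ≤ L * ((1 / c) ^ μ * K * Real.exp (c * t) + (1 / c) ^ μ * K * Real.exp (c * t))
            + ϱ * ((1 / c) ^ (μ - κ) * K * Real.exp (c * t)) := by
          rw [abs_mul, abs_of_pos hϱ]
          exact add_le_add (hQ.trans (mul_le_mul_of_nonneg_left (add_le_add hd1 hd2) hL.le))
            (mul_le_mul_of_nonneg_left hr hϱ.le)
        _ = (L * (2 * (1 / c) ^ μ) + ϱ * (1 / c) ^ (μ - κ)) * (K * Real.exp (c * t)) := by ring
        _ ≤ 1 / 2 * (K * Real.exp (c * t)) := mul_le_mul_of_nonneg_right hc hE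
        _ = _ := by ring)
  have hder : ∀ ν, 0 < ν → ν ≤ μ → ∀ l ∈ Icc m n, HasDerivWithinAt
      (caputoPrimitive m n Φ ν (Z w)) (rlInt₀ (μ - ν) w (Φ l - Φ m) * dPhi m n Φ l)
      (Icc m n) l := by
    intro ν hν hνμ l hl
    refine ((hasDerivWithinAt_rlInt₀_rlInt hν hνμ hμ hw (hmem l hl)).comp l
      ((hΦd l hl).hasDerivWithinAt.sub_const (Φ m)) hmem).congr_of_mem (fun s hs => ?_) hl
    refine caputoPrimitive_eq_rlInt₀ hΦ hΦd ν (fun r hr => ?_) hs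
    rw [hZ, fracExtend_of_ge hr.1, fracExtend_of_le le_rfl, add_sub_cancel_left]
  have hval : ∀ ν, 0 < ν → ν ≤ μ → ∀ l ∈ Icc m n,
      caputoDeriv m n Φ ν (Z w) l = rlInt₀ (μ - ν) w (Φ l - Φ m) := by
    intro ν hν hνμ l hl
    rw [caputoDeriv, (hder ν hν hνμ l hl).derivWithin (uniqueDiffOn_Icc hmn l hl)]
    exact mul_div_cancel_right₀ _ (hΦne l hl)
  refine ⟨Z w, ⟨continuousOn_fracExtend hmn.le hσ.le hμ0 hμ hΦd.continuousOn hα hw, fun l hl =>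
    ⟨(hder μ hμ0 le_rfl l hl).differentiableWithinAt,
      (hder κ hκ hκμ.le l hl).differentiableWithinAt⟩⟩, fun l hl => ?_,
    fun l hl => fracExtend_of_le hl.2⟩
  have h := hweq _ (hmem l hl)
  rw [hψΦ l hl] at h
  rw [hval μ hμ0 le_rfl l hl, hval κ hκ hκμ.le l hl, sub_self, rlInt₀, if_pos rfl, rlInt₀,
    if_neg hβ.ne', h]
  ring

/-- The stability estimate. It is also used with `ε = 0`, where it gives uniqueness. -/
lemma abs_sub_le_of_isApproxSolution (hmn : m < n) (hσ : 0 < σ) (hκ : 0 < κ) (hκμ : κ < μ)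
    (hμ : μ ≤ 1) (hϱ : 0 < ϱ) (hΦ : StrictMonoOn Φ (Icc m n))
    (hΦd : DifferentiableOn ℝ Φ (Icc m n))
    (hΦne : ∀ l ∈ Icc m n, derivWithin Φ (Icc m n) l ≠ 0) (hfcont : ContinuousOn f (Icc m n))
    (hfmaps : MapsTo f (Icc m n) (Icc (m - σ) n)) (hfdelay : ∀ l ∈ Icc m n, f l ≤ l)
    (hQcont : ContinuousOn (fun p : ℝ × ℝ × ℝ => Q p.1 p.2.1 p.2.2) (Icc m n ×ˢ univ))
    (hL : 0 < L) (hQlip : ∀ l ∈ Icc m n, ∀ a₁ a₂ b₁ b₂ : ℝ,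
      |Q l b₂ a₂ - Q l b₁ a₁| ≤ L * (|b₂ - b₁| + |a₂ - a₁|))
    {ε : ℝ} (hε : 0 ≤ ε) {y z : ℝ → ℝ} (hy : IsApproxSolution m n σ Φ μ κ ϱ Q f ε y)
    (hz : IsSolution m n σ Φ μ κ ϱ Q f y z) {l : ℝ} (hl : l ∈ Icc m n) :
    |y l - z l| ≤ mittagLeffler μ (2 * L * (Φ n - Φ m) ^ μ) * ε
      * mittagLeffler μ ((Φ l - Φ m) ^ μ) := by
  obtain ⟨⟨hyc, hyd⟩, hyr⟩ := hy
  obtain ⟨⟨hzc, hzd⟩, hzeq, hzy⟩ := hz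
  have hμ0 : 0 < μ := hκ.trans hκμ
  have hβ : 0 < μ - κ := sub_pos.2 hκμ
  have hsub : Icc m n ⊆ Icc (m - σ) n := Icc_subset_Icc_left (by linarith)
  obtain ⟨ψ, hψ, hψm, hψΦ, hΦψ⟩ := exists_inverse_time hmn.le hΦ hΦd.continuousOn
  have hmem : ∀ l ∈ Icc m n, Φ l - Φ m ∈ Icc 0 (Φ n - Φ m) := fun l hl =>
    ⟨sub_nonneg.2 (hΦ.monotoneOn ⟨le_rfl, hmn.le⟩ hl hl.1),
      sub_le_sub_right (hΦ.monotoneOn hl ⟨hmn.le, le_rfl⟩ hl.2) _⟩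
  set T := Φ n - Φ m with hTdef
  have hgy := continuous_nonlinearity hfcont hfmaps hσ.le hQcont hψ hψm hyc
  have hgz := continuous_nonlinearity hfcont hfmaps hσ.le hQcont hψ hψm hzc
  obtain ⟨My, -, hMy⟩ := hgy.locBdd.bound T
  obtain ⟨Mz, -, hMz⟩ := hgz.locBdd.bound T
  obtain ⟨hy', hyl, hyin, hyout, hyeq⟩ := exists_source (C := ε * mlPow μ T + My) hmn hκ hκμ hμ hΦ
    hΦd hΦne hψ hψm hψΦ hΦψ (hyc.mono hsub) hyd (fun l hl => by
      have h1 := hyr l hl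
      rw [← mlPow_of_nonneg (hmem l hl).1] at h1
      have h2 := hMy _ (hmem l hl)
      rw [hψΦ l hl] at h2
      have h3 : ε * mlPow μ (Φ l - Φ m) ≤ ε * mlPow μ T :=
        mul_le_mul_of_nonneg_left (monotone_mlPow hμ0 (hmem l hl).2) hε
      have h4 := abs_add_le (residual m n Φ μ κ ϱ Q f y l) (Q l (y l) (y (f l)))
      rw [residual, sub_add_cancel] at h4
      exact h4.trans (add_le_add (h1.trans h3) h2))
  obtain ⟨hz', hzl, hzin, hzout, hzeq'⟩ := exists_source (C := Mz) hmn hκ hκμ hμ hΦ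
    hΦd hΦne hψ hψm hψΦ hΦψ (hzc.mono hsub) hzd (fun l hl => by
      have h2 := hMz _ (hmem l hl)
      rw [hψΦ l hl] at h2
      rw [hzeq l hl]
      exact h2)
  have hzm : z m = y m := hzy m ⟨by linarith, le_rfl⟩
  have huy : Continuous fun t => y (ψ t) - y m :=
    ((hyc.mono hsub).comp_continuous hψ hψm).sub continuous_const
  have huz : Continuous fun t => z (ψ t) - z m :=
    ((hzc.mono hsub).comp_continuous hψ hψm).sub continuous_const
  set e : ℝ → ℝ := fun t => (y (ψ t) - y m) - (z (ψ t) - z m) with he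
  have hec : Continuous e := huy.sub huz
  have he' : ∀ t, e t = y (ψ t) - z (ψ t) := fun t => by rw [he]; simp only [hzm]; ring
  set t₀ := Φ l - Φ m with ht₀
  have ht₀T : t₀ ∈ Icc 0 T := hmem l hl
  have hm0 : 0 ≤ mlPow μ t₀ := zero_le_one.trans (one_le_mlPow hμ0 _)
  -- on `[0, t₀]` the source term `ε M_μ(t^μ)` may be replaced by its largest value, at `t₀`
  have hgron := le_mittagLeffler_of_improving_bound (a := μ) (A := 2 * L) (b := ε * mlPow μ t₀)
    (t := t₀) hμ0 (by positivity) (by positivity) ht₀T.1 hec.abs ?_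
  · rw [he', hψΦ l hl] at hgron
    refine hgron.trans ?_
    rw [← mlPow_of_nonneg ht₀T.1, mul_comm (ε * mlPow μ t₀),
      mul_assoc (mittagLeffler μ (2 * L * T ^ μ))]
    refine mul_le_mul_of_nonneg_right (mittagLeffler_mono hμ0 ?_ ?_)
      (mul_nonneg hε hm0)
    · exact mul_nonneg (by positivity) (Real.rpow_nonneg ht₀T.1 _)
    · exact mul_le_mul_of_nonneg_left (Real.rpow_le_rpow ht₀T.1 ht₀T.2 hμ0.le) (by positivity)
  intro B hB hBm hBe s hs
  have hB0 : ∀ r ∈ Icc 0 t₀, 0 ≤ B r := fun r hr => (abs_nonneg _).trans (hBe r hr)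
  set H : ℝ → ℝ := fun r => 2 * L * B r + ε * mlPow μ r with hH
  have hm0' : ∀ r, 0 ≤ ε * mlPow μ r := fun r =>
    mul_nonneg hε (zero_le_one.trans (one_le_mlPow hμ0 _))
  have hHl : LocBdd H := (hB.const_mul _).add ((locBdd_mlPow hμ0).const_mul ε)
  have hbound : ∀ r ∈ Ioc 0 t₀, |hy' r - hz' r| ≤ H r := by
    intro r hr
    have hr' : r ∈ Icc 0 t₀ := Ioc_subset_Icc_self hr
    have hrT : r ∈ Icc 0 T := ⟨hr'.1, hr'.2.trans ht₀T.2⟩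
    by_cases hrI : r ∈ Ioo 0 T
    swap
    · rw [hyout r hrI, hzout r hrI, sub_zero, abs_zero]
      exact add_nonneg (mul_nonneg (by positivity) (hB0 r hr')) (hm0' r)
    have hd1 : |y (ψ r) - z (ψ r)| ≤ B r := by rw [← he']; exact hBe r hr'
    -- the delayed argument lies either in the initial interval or at an earlier time
    have hd2 : |y (f (ψ r)) - z (f (ψ r))| ≤ B r := by
      have hfm := hfmaps (hψm r)
      rcases le_total (f (ψ r)) m with h | h
      · rw [hzy _ ⟨hfm.1, h⟩, sub_self, abs_zero]; exact hB0 r hr'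
      · have hx : f (ψ r) ∈ Icc m n := ⟨h, hfm.2⟩
        have hxr : Φ (f (ψ r)) - Φ m ≤ r := by
          conv_rhs => rw [← hΦψ r hrT]
          exact sub_le_sub_right (hΦ.monotoneOn hx (hψm r) (hfdelay _ (hψm r))) _
        have hxI : Φ (f (ψ r)) - Φ m ∈ Icc 0 t₀ := ⟨(hmem _ hx).1, hxr.trans hr.2⟩
        have := (hBe _ hxI).trans (hBm hxI hr' hxr)
        rwa [he', hψΦ _ hx] at this
    have hres := hyr (ψ r) (hψm r)
    rw [hΦψ r hrT, ← mlPow_of_nonneg hr.1.le] at hres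
    have hQ := hQlip (ψ r) (hψm r) (z (f (ψ r))) (y (f (ψ r))) (z (ψ r)) (y (ψ r))
    have hQ' := hQ.trans (mul_le_mul_of_nonneg_left (add_le_add hd1 hd2) hL.le)
    have hsplit : hy' r - hz' r = residual m n Φ μ κ ϱ Q f y (ψ r)
        + (Q (ψ r) (y (ψ r)) (y (f (ψ r))) - Q (ψ r) (z (ψ r)) (z (f (ψ r)))) := by
      rw [hyin r hrI, hzin r hrI, hzeq _ (hψm r), residual]; ring
    rw [hsplit]
    refine (abs_add_le _ _).trans ((add_le_add hres hQ').trans (le_of_eq ?_))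
    simp only [hH]; ring
  have hcomp := abs_le_rlInt_of_two_term (α := μ - κ) (κ := κ) (ϱ := ϱ) (T := t₀) hβ (by linarith)
    hκ (by linarith) hϱ (hyl.sub hzl) hHl hbound hec (fun r hr => by
      have hrT : r ∈ Icc 0 T := ⟨hr.1, hr.2.trans ht₀T.2⟩
      rw [add_sub_cancel, rlInt_sub hμ0 hyl hzl, he, rlInt_sub hβ huy.locBdd huz.locBdd]
      linear_combination hyeq r hrT - hzeq' r hrT) s hs
  rw [add_sub_cancel, rlInt_add hμ0 (hB.const_mul _) ((locBdd_mlPow hμ0).const_mul ε),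
    rlInt_const_mul, rlInt_const_mul] at hcomp
  have h1 : ε * rlInt μ (mlPow μ) s ≤ ε * mlPow μ t₀ :=
    mul_le_mul_of_nonneg_left ((rlInt_mlPow_le hμ0 hs.1).trans (monotone_mlPow hμ0 hs.2)) hε
  linarith

lemma isUHMLStableWith_mittagLeffler
    (hmn : m < n) (hσ : 0 < σ) (hκ : 0 < κ) (hκμ : κ < μ) (hμ : μ ≤ 1) (hϱ : 0 < ϱ)
    (hΦ : StrictMonoOn Φ (Icc m n))
    (hΦd : DifferentiableOn ℝ Φ (Icc m n))
    (hΦne : ∀ l ∈ Icc m n, derivWithin Φ (Icc m n) l ≠ 0)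
    (hfcont : ContinuousOn f (Icc m n))
    (hfmaps : MapsTo f (Icc m n) (Icc (m - σ) n))
    (hfdelay : ∀ l ∈ Icc m n, f l ≤ l)
    (hQcont : ContinuousOn (fun p : ℝ × ℝ × ℝ => Q p.1 p.2.1 p.2.2)
      (Icc m n ×ˢ (univ : Set (ℝ × ℝ))))
    (hL : 0 < L)
    (hQlip : ∀ l ∈ Icc m n, ∀ a₁ a₂ b₁ b₂ : ℝ,
      |Q l b₂ a₂ - Q l b₁ a₁| ≤ L * (|b₂ - b₁| + |a₂ - a₁|)) :
    IsUHMLStableWith m n σ Φ μ κ ϱ Q f (mittagLeffler μ (2 * L * (Φ n - Φ m) ^ μ)) := by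
  intro ε hε y hy
  obtain ⟨z, hz⟩ := exists_isSolution hmn hσ hκ hκμ hμ hϱ hΦ hΦd hΦne hfcont hfmaps
    hfdelay hQcont hL hQlip hy.1.1
  refine ⟨z, hz, fun w hw x hx => ?_, fun l hl => ?_, fun l hl =>
    abs_sub_le_of_isApproxSolution hmn hσ hκ hκμ hμ hϱ hΦ hΦd hΦne hfcont hfmaps
      hfdelay hQcont hL hQlip hε.le hy hz hl⟩
  · rcases le_total x m with h | h
    · rw [hw.2.2 x ⟨hx.1, h⟩, hz.2.2 x ⟨hx.1, h⟩]
    · have hw0 : IsApproxSolution m n σ Φ μ κ ϱ Q f 0 w :=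
        ⟨hw.1, fun l hl => by rw [PhiCaputo.residual, hw.2.1 l hl, sub_self, abs_zero, zero_mul]⟩
      have hzw : IsSolution m n σ Φ μ κ ϱ Q f w z :=
        ⟨hz.1, hz.2.1, fun l hl => by rw [hz.2.2 l hl, hw.2.2 l hl]⟩
      have := abs_sub_le_of_isApproxSolution hmn hσ hκ hκμ hμ hϱ hΦ hΦd hΦne hfcont
        hfmaps hfdelay hQcont hL hQlip le_rfl hw0 hzw ⟨h, hx.2⟩
      rw [mul_zero, zero_mul] at this
      exact sub_eq_zero.1 (abs_nonpos_iff.1 this)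
  · rw [hz.2.2 l hl, sub_self, abs_zero]

end Delay

end PhiCaputo

theorem mainTheorem2
    (m n σ μ κ ϱ L : ℝ) (Φ : ℝ → ℝ) (Q : ℝ → ℝ → ℝ → ℝ) (f : ℝ → ℝ)
    (hmn : m < n) (hσ : 0 < σ) (hκ : 0 < κ) (hκμ : κ < μ) (hμ : μ ≤ 1) (hϱ : 0 < ϱ)
    (hΦmono : StrictMonoOn Φ (Set.Icc m n))
    (hΦdiff : DifferentiableOn ℝ Φ (Set.Icc m n))
    (hΦne : ∀ l ∈ Set.Icc m n, derivWithin Φ (Set.Icc m n) l ≠ 0)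
    (hfcont : ContinuousOn f (Set.Icc m n))
    (hfmaps : Set.MapsTo f (Set.Icc m n) (Set.Icc (m - σ) n))
    (hfdelay : ∀ l ∈ Set.Icc m n, f l ≤ l)
    (hQcont : ContinuousOn (fun p : ℝ × ℝ × ℝ => Q p.1 p.2.1 p.2.2)
      (Set.Icc m n ×ˢ (Set.univ : Set (ℝ × ℝ))))
    (hL : 0 < L)
    (hQlip : ∀ l ∈ Set.Icc m n, ∀ a₁ a₂ b₁ b₂ : ℝ,
      |Q l b₂ a₂ - Q l b₁ a₁| ≤ L * (|b₂ - b₁| + |a₂ - a₁|)) :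
    PhiCaputo.IsUHMLStable m n σ Φ μ κ ϱ Q f ∧
    0 < PhiCaputo.mittagLeffler μ (2 * L * (Φ n - Φ m) ^ μ) ∧
    PhiCaputo.IsUHMLStableWith m n σ Φ μ κ ϱ Q f
      (PhiCaputo.mittagLeffler μ (2 * L * (Φ n - Φ m) ^ μ)) := by
  have hT : 0 ≤ Φ n - Φ m :=
    sub_nonneg.2 (hΦmono.monotoneOn ⟨le_rfl, hmn.le⟩ ⟨hmn.le, le_rfl⟩ hmn.le)
  have hpos : 0 < PhiCaputo.mittagLeffler μ (2 * L * (Φ n - Φ m) ^ μ) :=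
    one_pos.trans_le (PhiCaputo.one_le_mittagLeffler (hκ.trans hκμ)
      (mul_nonneg (by positivity) (Real.rpow_nonneg hT _)))
  have hstab := PhiCaputo.isUHMLStableWith_mittagLeffler hmn hσ hκ hκμ hμ hϱ hΦmono hΦdiff hΦne
    hfcont hfmaps hfdelay hQcont hL hQlip
  exact ⟨⟨_, hpos, hstab⟩, hpos, hstab⟩
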